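/- Let $G=(V,E)$ be a finite directed acyclic network (parallel channels allowed, every channel of unit capacity) with a single source node $s$ that has no incoming channels, let $\omega\ge 1$ be an integer and let $\mathcal F$ be a field. Cuts and codes. For a nonempty collection $T$ of non-source nodes let $C_T$ be the minimum number of channels whose removal disconnects $s$ from every $t\in T$; write $C_t=C_{\{t\}}$ and $\delta_T=C_T-\omega$. Let $In(s)=\{d_1',\dots,d_\omega'\}$ be $\omega$ imaginary channels entering $s$; for $i\ne s$ let $In(i)$ be the set of channels with head $i$, and put $In(T)=\bigcup_{t\in T}In(t)$. An $\omega$-dimensional $\mathcal F$-valued linear network error correction (LNEC) code on $G$ is given by coefficients $k_{d,e}\in\mathcal F$ ($e\in E$, $d\in In(tail(e))$) and the vectors $\tilde f_e\in\mathcal F^{In(s)\cup E}$ determined by $\tilde f_{d_i'}=1_{d_i'}$ and $\tilde f_e=\sum_{d\in In(tail(e))}k_{d,e}\tilde f_d+1_e$ for $e\in E$, where $1_d$ is the indicator vector of $d$. For $d\in In(s)\cup E$ let $row_T(d)=(\tilde f_e(d))_{e\in In(T)}$. Put $\Phi(T)=\langle row_T(d_i'):1\le i\le\omega\rangle$ and,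 for an error pattern $\rho\subseteq E$, $\Delta(T,\rho)=\langle row_T(e):e\in\rho\rangle$. Let $rank_T(\rho)$ be the least $|\rho'|$ over all $\rho'\subseteq E$ such that $\Delta(T,\rho)\subseteq\Delta(T,\rho')$ for every LNEC code on $G$, and let $R_T(\delta,G)=\{\rho\subseteq E:|\rho|=rank_T(\rho)=\delta\}$. The minimum distance at $T$ is $$d_{\min}^{(T)}(G)=\min rank_T(\rho)=\min|\rho|=\min\dim\Delta(T,\rho),$$ each minimum being over all $\rho$ with $\Delta(T,\rho)\cap\Phi(T)\ne\{0\}$ (such $\rho$ exist only if $C_T\ge1$). The code is a dispersion MDS code if, for every nonempty collection $T$ of non-source nodes, $\dim\Phi(T)=\min\{\omega,C_T\}$ (strong sup-regularity) and the extended Singleton bound holds with equality: the three minima exist and are equal, with $d_{\min}^{(T)}(G)=\delta_T+1$ if $C_T\ge\omega$, and $d_{\min}^{(T)}(G)=1$ if $1\le C_T<\omega$. Enlarged network. Let $\mathcal T$ be the set of all nonempty collections of non-source nodes of $G$. Let $G'$ be obtained from $G$ by adding, for every $T\in\mathcal T$, a new node $t_T$ and, for every $t\in T$, $C_t$ parallel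 channels from $t$ to $t_T$. Let $V_3=\{T\in\mathcal T:C_T<\omega\}$, and write $R_{t_T}(\delta,G')$ for $R_{\{t_T\}}(\delta,G')$. Theorem. If $$|\mathcal F|>\sum_{T\in\mathcal T:\ C_T\ge\omega}|R_{t_T}(\delta_T,G')|+|V_3|,$$ then there exists an $\omega$-dimensional $\mathcal F$-valued LNEC dispersion MDS code on $G$. -/

import Mathlib

universe w u v

namespace LNEC

/-- A finite (when `V` and `E` are) directed acyclic multigraph with node set `V`, channel set `E`
of unit-capacity channels, and a single source node that has no incoming channels. -/
structure Network (V : Type u) (E : Type v) where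
  source : V
  tail : E → V
  head : E → V
  acyclic : ∀ x : V, ¬ Relation.TransGen (fun a b => ∃ e, tail e = a ∧ head e = b) x x
  source_no_in : ∀ e : E, head e ≠ source

namespace Network

variable {V : Type u} {E : Type v}

/-- Nonempty collections of non-source nodes. -/
abbrev Coll (G : Network V E) : Type u := {T : Finset V // T.Nonempty ∧ G.source ∉ T}

/-- `G.Reaches A x`: there is a directed path from the source to `x` that uses no channel of `A`. -/
def Reaches (G : Network V E) (A : Finset E) (x : V) : Prop :=
  Relation.ReflTransGen (fun a b => ∃ e, e ∉ A ∧ G.tail e = a ∧ G.head e = b) G.source x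

/-- `A` is a cut between the source and the collection `T`: removing the channels of `A`
disconnects the source from every node of `T`. -/
def IsCut (G : Network V E) (T : Finset V) (A : Finset E) : Prop :=
  ∀ t ∈ T, ¬ G.Reaches A t

/-- The minimum cut capacity `C_T` between the source and the collection `T`. -/
noncomputable def minCut (G : Network V E) (T : Finset V) : ℕ :=
  sInf {n | ∃ A : Finset E, G.IsCut T A ∧ A.card = n}

/-- The head of a channel of `In(s) ∪ E`, where `In(s) = {d'_1, …, d'_n}` consists of `n` imaginary
message channels entering the source. -/
def extHead (G : Network V E) (n : ℕ) : Fin n ⊕ E → V :=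
  Sum.elim (fun _ => G.source) G.head

/-- The set `In(x)` of incoming channels of the node `x`; for the source these are
the `n` imaginary message channels. -/
def inChannels [Fintype E] [DecidableEq V] (G : Network V E) (n : ℕ) (x : V) :
    Finset (Fin n ⊕ E) :=
  Finset.univ.filter (fun d => G.extHead n d = x)

/-- An `n`-dimensional `K`-valued linear network error correction code on `G`: local encoding
coefficients `k d e` (only the values at adjacent pairs, `d ∈ In(tail e)`, matter), together with
the extended global encoding kernels they determine. The vector `kernel d` has its entries
indexed by `In(s) ∪ E`. -/
structure Code [Fintype E] [DecidableEq V] [DecidableEq E] (G : Network V E)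
    (K : Type w) [Field K] (n : ℕ) where
  k : Fin n ⊕ E → E → K
  kernel : Fin n ⊕ E → (Fin n ⊕ E → K)
  kernel_message : ∀ i : Fin n, kernel (Sum.inl i) = Pi.single (Sum.inl i) 1
  kernel_channel : ∀ e : E, kernel (Sum.inr e) =
    (∑ d ∈ G.inChannels n (G.tail e), k d e • kernel d) + Pi.single (Sum.inr e) 1

namespace Code

variable [Fintype E] [DecidableEq V] [DecidableEq E] {G : Network V E}
  {K : Type w} [Field K] {n : ℕ}

/-- The row of the decoding matrix of `T` indicated by `d ∈ In(s) ∪ E`. The columns are indexed by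
`In(T)`, the set of channels whose head lies in `T`. -/
def row (c : G.Code K n) (T : Finset V) (d : Fin n ⊕ E) : {e : E // G.head e ∈ T} → K :=
  fun e => c.kernel (Sum.inr e.1) d

/-- The message space `Φ(T)`. -/
def messageSpace (c : G.Code K n) (T : Finset V) : Submodule K ({e : E // G.head e ∈ T} → K) :=
  Submodule.span K (Set.range fun i : Fin n => c.row T (Sum.inl i))

/-- The error space `Δ(T, ρ)` of the error pattern `ρ`. -/
def errorSpace (c : G.Code K n) (T : Finset V) (ρ : Finset E) :
    Submodule K ({e : E // G.head e ∈ T} → K) :=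
  Submodule.span K ((fun e : E => c.row T (Sum.inr e)) '' (ρ : Set E))

end Code

section Rank

variable [Fintype E] [DecidableEq V] [DecidableEq E]

/-- The error pattern `ρ₁` is dominated by `ρ₂` with respect to `T`: `Δ(T, ρ₁) ⊆ Δ(T, ρ₂)` for
every linear network error correction code on `G`. -/
def Dominated (G : Network V E) (T : Finset V) (ρ₁ ρ₂ : Finset E) : Prop :=
  ∀ (K : Type w) [Field K] (n : ℕ) (c : G.Code K n), c.errorSpace T ρ₁ ≤ c.errorSpace T ρ₂

/-- The rank of an error pattern with respect to `T`. -/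
noncomputable def errorRank (G : Network V E) (T : Finset V) (ρ : Finset E) : ℕ :=
  sInf {m | ∃ ρ' : Finset E, Dominated.{w} G T ρ ρ' ∧ ρ'.card = m}

/-- The set `R_T(δ, G)` of error patterns `ρ` with `|ρ| = rank_T(ρ) = δ`. -/
def fullRankPatterns (G : Network V E) (T : Finset V) (δ : ℕ) : Set (Finset E) :=
  {ρ | ρ.card = δ ∧ errorRank.{w} G T ρ = δ}

end Rank

namespace Code

variable [Fintype E] [DecidableEq V] [DecidableEq E] {G : Network V E}
  {K : Type w} [Field K] {n : ℕ}

/-- The error patterns `ρ` with `Δ(T, ρ) ∩ Φ(T) ≠ {0}`. -/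
def confusable (c : G.Code K n) (T : Finset V) : Set (Finset E) :=
  {ρ | c.errorSpace T ρ ⊓ c.messageSpace T ≠ ⊥}

/-- The minimum distance of `c` at `T` exists and equals `d`. It is defined by three minima (of the
rank, of the cardinality, of the dimension of the error space, over all `ρ` with
`Δ(T, ρ) ∩ Φ(T) ≠ {0}`), and all three are required to exist and to be equal to `d`. -/
def HasMinDistance (c : G.Code K n) (T : Finset V) (d : ℕ) : Prop :=
  IsLeast (errorRank.{w} G T '' c.confusable T) d ∧
  IsLeast (Finset.card '' c.confusable T) d ∧
  IsLeast ((fun ρ => Module.finrank K (c.errorSpace T ρ)) '' c.confusable T) d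

/-- Strong sup-regularity (the dispersion property): `dim Φ(T) = min {n, C_T}` for every
collection `T` of non-source nodes. -/
def StronglySupRegular (c : G.Code K n) : Prop :=
  ∀ T : G.Coll, Module.finrank K (c.messageSpace T.1) = min n (G.minCut T.1)

/-- Dispersion MDS code: strongly sup-regular, and the extended Singleton bound holds with equality
at every nonempty collection `T` of non-source nodes, namely `d_min = C_T - n + 1` if `C_T ≥ n` and
`d_min = 1` if `C_T < n`. If `C_T = 0 < n` then nothing sent by the source arrives at `T`, so
`Φ(T) = {0}` and there is no minimum distance to speak of. -/
def IsDispersionMDS (c : G.Code K n) : Prop :=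
  c.StronglySupRegular ∧
  ∀ T : G.Coll,
    (n ≤ G.minCut T.1 → c.HasMinDistance T.1 (G.minCut T.1 - n + 1)) ∧
    (0 < G.minCut T.1 → G.minCut T.1 < n → c.HasMinDistance T.1 1)

end Code

/-- The channels added in the enlarged network: for each nonempty collection `T` of non-source
nodes and each `t ∈ T`, there are `C_t` of them. -/
abbrev NewChannel (G : Network V E) : Type u :=
  Σ T : G.Coll, Σ t : {t : V // t ∈ T.1}, Fin (G.minCut {t.1})

/-- Tails in the enlarged network. -/
def enlargedTail (G : Network V E) : E ⊕ G.NewChannel → V ⊕ G.Coll :=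
  Sum.elim (fun e => Sum.inl (G.tail e)) (fun x => Sum.inl x.2.1.1)

/-- Heads in the enlarged network. -/
def enlargedHead (G : Network V E) : E ⊕ G.NewChannel → V ⊕ G.Coll :=
  Sum.elim (fun e => Sum.inl (G.head e)) (fun x => Sum.inr x.1)

theorem enlarged_transGen (G : Network V E) {a b : V ⊕ G.Coll}
    (h : Relation.TransGen
      (fun a b => ∃ e, G.enlargedTail e = a ∧ G.enlargedHead e = b) a b) :
    ∃ x, a = Sum.inl x ∧ ∀ y, b = Sum.inl y →
      Relation.TransGen (fun a b => ∃ e, G.tail e = a ∧ G.head e = b) x y := by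
  induction h with
  | single h =>
    obtain ⟨e | e, rfl, rfl⟩ := h
    · refine ⟨G.tail e, rfl, fun y hy => ?_⟩
      exact Relation.TransGen.single ⟨e, rfl, Sum.inl_injective hy⟩
    · refine ⟨e.2.1.1, rfl, fun y hy => ?_⟩
      simp [enlargedHead] at hy
  | tail _ h ih =>
    obtain ⟨x, hx, ih⟩ := ih
    obtain ⟨e | e, rfl, rfl⟩ := h
    · refine ⟨x, hx, fun y hy => ?_⟩
      exact (ih (G.tail e) rfl).tail ⟨e, rfl, Sum.inl_injective hy⟩
    · refine ⟨x, hx, fun y hy => ?_⟩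
      simp [enlargedHead] at hy

/-- The enlarged network `G'`: for every nonempty collection `T` of non-source nodes of `G` there
is a new node `t_T`, here `Sum.inr T`, and `C_t` parallel channels from `t` to `t_T` for
each `t ∈ T`. -/
def enlarged (G : Network V E) : Network (V ⊕ G.Coll) (E ⊕ G.NewChannel) where
  source := Sum.inl G.source
  tail := G.enlargedTail
  head := G.enlargedHead
  acyclic := by
    intro a h
    obtain ⟨x, rfl, hx⟩ := G.enlarged_transGen h
    exact G.acyclic x (hx x rfl)
  source_no_in := by
    rintro (e | e) h
    · exact G.source_no_in e (Sum.inl_injective h)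
    · simp [enlargedHead] at h

/-- The bound `∑_{T : C_T ≥ n} |R_{t_T}(δ_T, G')| + |{T : C_T < n}|`, where `δ_T = C_T - n` and `T`
runs over the nonempty collections of non-source nodes of `G`. -/
noncomputable def dispersionBound [Fintype V] [Fintype E] [DecidableEq V] [DecidableEq E]
    (G : Network V E) (n : ℕ) : ℕ :=
  (∑ T ∈ Finset.univ.filter (fun T : G.Coll => n ≤ G.minCut T.1),
    (fullRankPatterns.{w} G.enlarged {Sum.inr T} (G.minCut T.1 - n)).ncard) +
  (Finset.univ.filter (fun T : G.Coll => G.minCut T.1 < n)).card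

end Network

end LNEC

/-! The code is built on the enlarged network, where each collection `T` becomes a single node
`t_T`, and is then restricted to `G`. Since the rows at `t_T` are a linear image of the rows at `T`,
independence and separation of messages from errors pull back from `t_T` to `T`
(`isDispersionMDS_restrict`). It therefore suffices that, when `C_T ≥ ω`, the `ω` message rows stay
independent together with the rows of every relevant error pattern of size `δ_T`, and, when `C_T <
ω`, that `C_T` message rows are independent.

There is one such independence condition for each pair `(T, ρ)` in the first case and one for each
`T` in the second. Along a line in a single local coefficient, all rows move by multiples of one
fixed vector (`row_ofPoint_update`), so a condition fails for at most one value of the coefficient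
unless it fails identically. Replacing coordinates one at a time by elements of `F` then meets all
conditions at once, as soon as `|F|` exceeds their number and each can be met separately over some
extension `K` (`exists_common_point`).

Separate satisfiability comes from max-flow min-cut. A generic code of dimension `C_T` over the
infinite field `K` has independent messages at `t_T`. Given an independent pattern `ρ` of size `δ_T
= C_T - ω`, Steinitz exchange leaves `ω` messages independent of `ρ`
(`exists_linearIndepOn_messages_union`). Only patterns independent in this generic code need
testing. They are all full rank patterns, which gives the bound, and every smaller independent
pattern extends to one of them. -/

namespace LNEC

namespace Network

/-! ### Numbering the channels along the network -/

section Order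

variable {V : Type u} {E : Type v}

theorem exists_injective_topological_order [Fintype E] (G : Network V E) :
    ∃ pos : E → ℕ, Function.Injective pos ∧ ∀ d e, G.head d = G.tail e → pos d < pos e := by
  classical
  let r : E → E → Prop := fun d e => G.head d = G.tail e
  have hirr : ∀ e, ¬ Relation.TransGen r e e := by
    intro e h
    refine G.acyclic (G.tail e) (h.lift G.tail ?_)
    exact fun a b hab => ⟨a, rfl, hab⟩
  let lev : E → ℕ := fun e => (Finset.univ.filter fun d => Relation.TransGen r d e).card
  have hlev : ∀ d e, r d e → lev d < lev e := by
    intro d e h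
    apply Finset.card_lt_card
    rw [Finset.ssubset_iff_of_subset]
    · exact ⟨d, by simpa using Relation.TransGen.single h, by simpa using hirr d⟩
    · intro x hx
      simp only [Finset.mem_filter, Finset.mem_univ, true_and] at hx ⊢
      exact hx.tail h
  let φ := Fintype.equivFin E
  -- The number of ancestors decides the order; the last digit in base `|E|` breaks ties.
  refine ⟨fun e => lev e * Fintype.card E + φ e, ?_, ?_⟩
  · intro a b h
    have h' := congrArg (· % Fintype.card E) h
    simp only [Nat.mul_add_mod_self_right, Nat.mod_eq_of_lt (φ a).isLt,
      Nat.mod_eq_of_lt (φ b).isLt] at h'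
    exact φ.injective (Fin.ext h')
  · intro d e h
    have h1 := Nat.mul_le_mul_right (Fintype.card E) (hlev d e h)
    have h2 := (φ d).isLt
    simp only [Nat.succ_eq_add_one, Nat.add_mul, Nat.one_mul] at h1
    show lev d * Fintype.card E + φ d < lev e * Fintype.card E + φ e
    omega

/-- A numbering of `In(s) ∪ E` along which the network can be traversed. -/
theorem exists_topological_order [Fintype E] (G : Network V E) (n : ℕ) :
    ∃ pos : Fin n ⊕ E → ℕ, (∀ d e, G.extHead n d = G.tail e → pos d < pos (Sum.inr e)) ∧
      ∀ e e', pos (Sum.inr e) = pos (Sum.inr e') → e = e' := by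
  obtain ⟨pos, hinj, hpos⟩ := G.exists_injective_topological_order
  refine ⟨Sum.elim (fun _ => 0) (fun e => pos e + 1), ?_, ?_⟩
  · rintro (i | d) e h
    · simp
    · simpa using hpos d e h
  · intro e e' h
    exact hinj (by simpa using h)

end Order

/-! ### The matrix of kernels, and its recursions in both directions -/

section Transfer

variable {V : Type u} {E : Type v} [Fintype E] [DecidableEq V] [DecidableEq E]
  (G : Network V E) {K : Type w} [Field K] {n : ℕ}

/-- The matrix of the local encoding coefficients, indexed by `In(s) ∪ E`. -/
def coefMatrix (k : Fin n ⊕ E → E → K) : Matrix (Fin n ⊕ E) (Fin n ⊕ E) K :=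
  Matrix.of fun d x => Sum.elim (fun _ => 0)
    (fun e => if G.extHead n d = G.tail e then k d e else 0) x

omit [Fintype E] [DecidableEq E] in
@[simp] theorem coefMatrix_inl (k : Fin n ⊕ E → E → K) (d : Fin n ⊕ E) (i : Fin n) :
    G.coefMatrix k d (Sum.inl i) = 0 := rfl

omit [Fintype E] [DecidableEq E] in
@[simp] theorem coefMatrix_inr (k : Fin n ⊕ E → E → K) (d : Fin n ⊕ E) (e : E) :
    G.coefMatrix k d (Sum.inr e) = if G.extHead n d = G.tail e then k d e else 0 := rfl

/-- Acyclicity: a row vector fixed by the coefficient matrix vanishes, by induction along the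
numbering of the channels. -/
theorem isUnit_one_sub_coefMatrix (k : Fin n ⊕ E → E → K) : IsUnit (1 - G.coefMatrix k) := by
  obtain ⟨pos, hpos, -⟩ := G.exists_topological_order n
  rw [← Matrix.vecMul_injective_iff_isUnit]
  rw [← Matrix.coe_vecMulLinear, ← LinearMap.ker_eq_bot, LinearMap.ker_eq_bot']
  intro v hv
  have hv' : ∀ x, v x = ∑ d, v d * G.coefMatrix k d x := by
    intro x
    have := congrFun hv x
    simp only [Matrix.vecMulLinear_apply, Matrix.vecMul_sub, Matrix.vecMul_one, Pi.sub_apply,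
      Pi.zero_apply, sub_eq_zero] at this
    exact this
  have key : ∀ m x, pos x ≤ m → v x = 0 := by
    intro m
    induction m using Nat.strong_induction_on with
    | _ m ih =>
      intro x hx
      rw [hv' x]
      refine Finset.sum_eq_zero fun d _ => ?_
      rcases x with i | e
      · simp
      · rw [coefMatrix_inr]
        split_ifs with h
        · rw [ih (pos d) ((hpos d e h).trans_le hx) d le_rfl, zero_mul]
        · simp
  exact funext fun x => key (pos x) x le_rfl

namespace Code

variable {G}

theorem kernel_inr_apply (c : G.Code K n) (e : E) (x : Fin n ⊕ E) :
    c.kernel (Sum.inr e) x =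
      (∑ d, (if G.extHead n d = G.tail e then c.k d e else 0) * c.kernel d x) +
        if x = Sum.inr e then 1 else 0 := by
  rw [c.kernel_channel, inChannels, Finset.sum_filter, Pi.add_apply, Finset.sum_apply,
    Pi.single_apply]
  congr 1
  refine Finset.sum_congr rfl fun d _ => ?_
  split_ifs <;> simp

/-- The matrix whose columns are the extended global encoding kernels. -/
def transfer (c : G.Code K n) : Matrix (Fin n ⊕ E) (Fin n ⊕ E) K :=
  Matrix.of fun d x => c.kernel x d

theorem transfer_eq_one_add_mul (c : G.Code K n) :
    c.transfer = 1 + c.transfer * G.coefMatrix c.k := by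
  ext d x
  rcases x with i | e
  · simp only [transfer, Matrix.of_apply, c.kernel_message, Matrix.add_apply, Matrix.mul_apply,
      coefMatrix_inl, mul_zero, Finset.sum_const_zero, add_zero, Matrix.one_apply, Pi.single_apply]
  · simp only [transfer, Matrix.of_apply, c.kernel_inr_apply, Matrix.add_apply, Matrix.mul_apply,
      coefMatrix_inr, Matrix.one_apply]
    rw [add_comm]
    simp only [mul_comm]

theorem transfer_mul (c : G.Code K n) : c.transfer * (1 - G.coefMatrix c.k) = 1 := by
  rw [mul_sub, mul_one]
  nth_rewrite 1 [c.transfer_eq_one_add_mul]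
  simp

/-- A one-sided inverse of a square matrix is two-sided, so the forward recursion that defines the
kernels also yields a backward recursion for the rows. -/
theorem transfer_eq_one_add_coefMatrix_mul (c : G.Code K n) :
    c.transfer = 1 + G.coefMatrix c.k * c.transfer := by
  have h := mul_eq_one_comm.1 c.transfer_mul
  rw [sub_mul, one_mul, sub_eq_iff_eq_add] at h
  exact h

/-- A code is determined by its local encoding coefficients at the adjacent pairs. -/
theorem kernel_congr {c c' : G.Code K n} (h : G.coefMatrix c.k = G.coefMatrix c'.k) :
    c.kernel = c'.kernel := by
  have h1 := c.transfer_mul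
  have h2 := mul_eq_one_comm.1 c'.transfer_mul
  rw [h] at h1
  have : c.transfer = c'.transfer := left_inv_eq_right_inv h1 h2
  funext x d
  exact congrFun (congrFun this d) x

variable (G) in
/-- The code with given local encoding coefficients. -/
noncomputable def ofCoeff (k : Fin n ⊕ E → E → K) : G.Code K n where
  k := k
  kernel := fun x d => (1 - G.coefMatrix k)⁻¹ d x
  kernel_message := by
    have h : (1 - G.coefMatrix k)⁻¹ * (1 - G.coefMatrix k) = 1 :=
      Matrix.nonsing_inv_mul _ ((Matrix.isUnit_iff_isUnit_det _).1 (G.isUnit_one_sub_coefMatrix k))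
    rw [mul_sub, mul_one, sub_eq_iff_eq_add] at h
    intro i
    funext d
    rw [h]
    simp [Matrix.mul_apply, Matrix.one_apply, Pi.single_apply]
  kernel_channel := by
    have h : (1 - G.coefMatrix k)⁻¹ * (1 - G.coefMatrix k) = 1 :=
      Matrix.nonsing_inv_mul _ ((Matrix.isUnit_iff_isUnit_det _).1 (G.isUnit_one_sub_coefMatrix k))
    rw [mul_sub, mul_one, sub_eq_iff_eq_add] at h
    intro e
    funext d
    conv_lhs => rw [h]
    rw [inChannels, Finset.sum_filter, Pi.add_apply, Finset.sum_apply, Pi.single_apply,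
      Matrix.add_apply, Matrix.mul_apply, Matrix.one_apply, add_comm]
    congr 1
    refine Finset.sum_congr rfl fun x _ => ?_
    rw [coefMatrix_inr]
    split_ifs <;> simp [mul_comm]

@[simp] theorem ofCoeff_k (k : Fin n ⊕ E → E → K) : (ofCoeff G k).k = k := rfl

theorem ofCoeff_k_kernel (c : G.Code K n) : (ofCoeff G c.k).kernel = c.kernel :=
  kernel_congr rfl

theorem row_eq_of_kernel_eq {c c' : G.Code K n} (h : c.kernel = c'.kernel) (T : Finset V) :
    c.row T = c'.row T := by
  funext d e
  simp [row, h]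

/-- Errors on a channel do not affect the channels upstream. -/
theorem kernel_eq_zero_of_adjacent (c : G.Code K n) {d : Fin n ⊕ E} {e : E}
    (h : G.extHead n d = G.tail e) : c.kernel d (Sum.inr e) = 0 := by
  obtain ⟨pos, hpos, -⟩ := G.exists_topological_order n
  have key : ∀ m x, pos x ≤ m → pos x < pos (Sum.inr e) → c.kernel x (Sum.inr e) = 0 := by
    intro m
    induction m using Nat.strong_induction_on with
    | _ m ih =>
      rintro (i | e') hx hlt
      · simp [c.kernel_message]
      · have hne : e ≠ e' := by rintro rfl; exact lt_irrefl _ hlt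
        rw [c.kernel_channel]
        simp only [Pi.add_apply, Finset.sum_apply, Pi.smul_apply, smul_eq_mul]
        rw [Pi.single_eq_of_ne (by simpa using hne), add_zero]
        refine Finset.sum_eq_zero fun d hd => ?_
        have hd' := hpos d e' (by simpa [inChannels] using hd)
        rw [ih (pos d) (hd'.trans_le hx) d le_rfl (hd'.trans hlt), mul_zero]
  exact key _ d le_rfl (hpos d e h)

/-- Backward recursion for the rows. -/
theorem row_eq (c : G.Code K n) (T : Finset V) (d : Fin n ⊕ E) :
    c.row T d = (fun e => if d = Sum.inr e.1 then 1 else 0) +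
      ∑ e : E, (if G.extHead n d = G.tail e then c.k d e else 0) • c.row T (Sum.inr e) := by
  funext x
  have h := congrFun (congrFun c.transfer_eq_one_add_coefMatrix_mul d) (Sum.inr x.1)
  simp only [transfer, Matrix.of_apply, Matrix.add_apply, Matrix.one_apply, Matrix.mul_apply,
    Fintype.sum_sum_type, coefMatrix_inl, zero_mul, Finset.sum_const_zero, zero_add,
    coefMatrix_inr] at h
  simp only [row, Pi.add_apply, Finset.sum_apply, Pi.smul_apply, smul_eq_mul]
  exact h

/-- Every message that arrives at `T` passes through each cut. -/
theorem messageSpace_le_errorSpace (c : G.Code K n) {T : Finset V} {A : Finset E}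
    (hA : G.IsCut T A) : c.messageSpace T ≤ c.errorSpace T A := by
  obtain ⟨pos, hpos, -⟩ := G.exists_topological_order n
  -- Induction from the far end of the network: `m` bounds how far the numbering continues beyond
  -- `d`.
  have key : ∀ m d, (∀ e, pos (Sum.inr e) ≤ pos d + m) → G.Reaches A (G.extHead n d) →
      c.row T d ∈ c.errorSpace T A := by
    intro m
    induction m using Nat.strong_induction_on with
    | _ m ih =>
      intro d hd hr
      rw [c.row_eq T d]
      have h0 : (fun e : {e : E // G.head e ∈ T} =>
          if d = Sum.inr e.1 then (1 : K) else 0) = 0 := by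
        funext e
        rw [if_neg]
        · rfl
        rintro rfl
        exact hA _ e.2 hr
      rw [h0, zero_add]
      refine Submodule.sum_mem _ fun e _ => ?_
      by_cases hde : G.extHead n d = G.tail e
      · refine Submodule.smul_mem _ _ ?_
        by_cases heA : e ∈ A
        · exact Submodule.subset_span ⟨e, heA, rfl⟩
        · have h1 := hpos d e hde
          have h2 := hd e
          refine ih (m - 1) (by omega) (Sum.inr e) (fun e' => ?_)
            (hr.tail ⟨e, heA, hde.symm, rfl⟩)
          have := hd e'
          omega
      · rw [if_neg hde, zero_smul]
        exact Submodule.zero_mem _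
  rw [messageSpace, Submodule.span_le]
  rintro _ ⟨i, rfl⟩
  obtain ⟨B, hB⟩ := (Set.finite_range fun e : E => pos (Sum.inr e)).bddAbove
  exact key B (Sum.inl i) (fun e => (hB ⟨e, rfl⟩).trans (Nat.le_add_left _ _)) .refl

end Code

end Transfer

end Network

end LNEC

/-! ### Independence along coordinate lines, and descent to a small field -/

namespace LNEC

/-- On a line in the direction of a matrix of rank one, linear independence of the rows fails at
most once unless it fails everywhere. -/
theorem eq_of_not_linearIndependent_add_smul {ι K M : Type*} [Fintype ι] [Field K]
    [AddCommGroup M] [Module K M] {r : ι → M} (hr : LinearIndependent K r) (u : ι → K) (v : M)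
    {x y : K} (hx : ¬ LinearIndependent K fun i => r i + (x * u i) • v)
    (hy : ¬ LinearIndependent K fun i => r i + (y * u i) • v) : x = y := by
  rw [Fintype.linearIndependent_iff] at hr
  -- A dependence at `z` must pair nontrivially with `u`, since the `r i` are independent; it is
  -- normalised to pair to `1`. Two such relations, at `x` and `y`, can then be compared.
  have key : ∀ z : K, (¬ LinearIndependent K fun i => r i + (z * u i) • v) →
      ∃ g : ι → K, ∑ i, g i • r i = -(z • v) ∧ ∑ i, g i * u i = 1 := by
    intro z hz
    obtain ⟨g, hg, i, hi⟩ := Fintype.not_linearIndependent_iff.1 hz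
    have h1 : ∑ i, g i • r i + (z * ∑ i, g i * u i) • v = 0 := by
      rw [← hg, Finset.mul_sum, Finset.sum_smul, ← Finset.sum_add_distrib]
      refine Finset.sum_congr rfl fun i _ => ?_
      rw [smul_add, smul_smul]
      congr 2
      ring
    have h2 : ∑ i, g i * u i ≠ 0 := by
      intro h
      rw [h, mul_zero, zero_smul, add_zero] at h1
      exact hi (hr g h1 i)
    refine ⟨fun i => (∑ i, g i * u i)⁻¹ * g i, ?_, ?_⟩
    · simp only [mul_smul, ← Finset.smul_sum]
      rw [eq_neg_of_add_eq_zero_left h1, smul_neg, smul_smul]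
      congr 2
      field_simp
    · simp only [mul_assoc, ← Finset.mul_sum]
      exact inv_mul_cancel₀ h2
  obtain ⟨g, hg, hg1⟩ := key x hx
  obtain ⟨h, hh, hh1⟩ := key y hy
  have h0 : ∀ i, y * g i - x * h i = 0 := by
    refine hr (fun i => y * g i - x * h i) ?_
    simp only [sub_smul, mul_smul, Finset.sum_sub_distrib, ← Finset.smul_sum]
    rw [hg, hh, smul_neg, smul_neg, smul_smul, smul_smul, mul_comm, sub_self]
  have h2 : ∑ i, (y * g i - x * h i) * u i = 0 :=
    Finset.sum_eq_zero fun i _ => by rw [h0, zero_mul]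
  simp only [sub_mul, mul_assoc, Finset.sum_sub_distrib, ← Finset.mul_sum, hg1, hh1, mul_one] at h2
  exact (sub_eq_zero.1 h2).symm

/-- Fewer than `|F|` conditions, each satisfiable over `K` and each failing at most once along a
coordinate line unless it fails everywhere on it, can be satisfied simultaneously over `F`. -/
theorem exists_common_point {F K ι J : Type*} [Field F] [Field K] [Algebra F K] [Fintype ι]
    [DecidableEq ι] [Fintype J] (hJ : (Fintype.card J : ℕ∞) < ENat.card F)
    (P : J → (ι → K) → Prop)
    (hP : ∀ j a, P j a → ∀ i x y, ¬ P j (Function.update a i x) → ¬ P j (Function.update a i y) →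
      x = y)
    (hne : ∀ j, ∃ a, P j a) : ∃ b : ι → F, ∀ j, P j (fun i => algebraMap F K (b i)) := by
  classical
  -- Each condition keeps its own witness over `K`; the witnesses are made to agree, with values in
  -- `F`, on one more coordinate at a time.
  suffices h : ∀ s : Finset ι, ∃ b : ι → F, ∀ j, ∃ a, P j a ∧ ∀ i ∈ s, a i = algebraMap F K (b i) by
    obtain ⟨b, hb⟩ := h Finset.univ
    refine ⟨b, fun j => ?_⟩
    obtain ⟨a, ha, hab⟩ := hb j
    have : a = fun i => algebraMap F K (b i) := funext fun i => hab i (Finset.mem_univ i)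
    rwa [← this]
  intro s
  induction s using Finset.induction_on with
  | empty =>
    refine ⟨0, fun j => ?_⟩
    obtain ⟨a, ha⟩ := hne j
    exact ⟨a, ha, by simp⟩
  | insert i s his ih =>
    obtain ⟨b, hb⟩ := ih
    choose a ha hab using hb
    obtain ⟨x, hx⟩ : ∃ x : F, ∀ j, P j (Function.update (a j) i (algebraMap F K x)) := by
      by_contra! h
      -- If every `x` were bad for some condition, choosing one would inject `F` into `J`, as each
      -- condition excludes at most one value.
      choose f hf using h
      have hinj : Function.Injective f := by
        intro x y hxy
        have h1 := hf x
        rw [hxy] at h1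
        exact (algebraMap F K).injective (hP (f y) (a (f y)) (ha (f y)) i _ _ h1 (hf y))
      have h2 := ENat.card_le_card_of_injective hinj
      rw [ENat.card_eq_coe_fintype_card (α := J)] at h2
      exact absurd hJ (not_lt.2 h2)
    refine ⟨Function.update b i x, fun j => ⟨_, hx j, fun i' hi' => ?_⟩⟩
    by_cases h : i' = i
    · subst h; simp
    · rw [Function.update_of_ne h, Function.update_of_ne h]
      exact hab j i' ((Finset.mem_insert.1 hi').resolve_left h)

namespace Network

variable {V : Type u} {E : Type v} [Fintype E] [DecidableEq V] [DecidableEq E]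

namespace Code

section Update

variable (G : Network V E) {K : Type w} [Field K] {n : ℕ}

/-- The code whose coefficients are the coordinates of a point. -/
noncomputable def ofPoint (a : (Fin n ⊕ E) × E → K) : G.Code K n :=
  ofCoeff G fun d e => a (d, e)

/-- Changing one matrix entry is a rank-one perturbation, so the resolvent identity changes the
inverse by a rank-one term. That term is exactly linear in the increment because the kernel of `d₀`
lies upstream of `e₀` and does not change. A coefficient at a nonadjacent pair has no effect. -/
theorem row_ofPoint_update (a : (Fin n ⊕ E) × E → K) (d₀ : Fin n ⊕ E) (e₀ : E) (T : Finset V) :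
    ∃ (u : Fin n ⊕ E → K) (r : {e : E // G.head e ∈ T} → K), ∀ t d,
      (ofPoint G (Function.update a (d₀, e₀) t)).row T d =
        (ofPoint G a).row T d + ((t - a (d₀, e₀)) * u d) • r := by
  by_cases hadj : G.extHead n d₀ = G.tail e₀
  · refine ⟨fun d => (ofPoint G a).kernel d₀ d, (ofPoint G a).row T (Sum.inr e₀), fun t d => ?_⟩
    set c := ofPoint G a with hc
    set c' := ofPoint G (Function.update a (d₀, e₀) t) with hc'
    have hM : c'.transfer = c.transfer +
        c'.transfer * (G.coefMatrix c'.k - G.coefMatrix c.k) * c.transfer := by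
      have h1 := c'.transfer_mul
      have h2 := mul_eq_one_comm.1 c.transfer_mul
      have h3 : G.coefMatrix c'.k - G.coefMatrix c.k =
        (1 - G.coefMatrix c.k) - (1 - G.coefMatrix c'.k) := by abel
      rw [h3, mul_sub, sub_mul, h1, mul_assoc, h2]
      simp
    have hK : ∀ p q, (G.coefMatrix c'.k - G.coefMatrix c.k) p q =
        if p = d₀ ∧ q = Sum.inr e₀ then t - a (d₀, e₀) else 0 := by
      intro p q
      rcases q with i | e
      · simp
      · simp only [Matrix.sub_apply, coefMatrix_inr, hc, hc', ofPoint, ofCoeff_k,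
          Function.update_apply, Prod.mk.injEq, Sum.inr.injEq]
        by_cases h : p = d₀ ∧ e = e₀
        · obtain ⟨rfl, rfl⟩ := h
          simp [hadj]
        · simp [h]
    have hentry : ∀ p q, c'.kernel q p =
        c.kernel q p + c'.kernel d₀ p * (t - a (d₀, e₀)) * c.kernel q (Sum.inr e₀) := by
      intro p q
      have h := congrFun (congrFun hM p) q
      rw [Matrix.add_apply, Matrix.mul_apply, Finset.sum_eq_single (Sum.inr e₀)] at h
      · rw [Matrix.mul_apply, Finset.sum_eq_single d₀] at h
        · rw [hK, if_pos ⟨rfl, rfl⟩] at h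
          exact h
        · intro x _ hx
          rw [hK, if_neg (by tauto), mul_zero]
        · simp
      · intro x _ hx
        rw [Matrix.mul_apply, Finset.sum_eq_zero, zero_mul]
        intro y _
        rw [hK, if_neg (by tauto), mul_zero]
      · simp
    have hd₀ : ∀ p, c'.kernel d₀ p = c.kernel d₀ p := by
      intro p
      rw [hentry p d₀, c.kernel_eq_zero_of_adjacent hadj, mul_zero, add_zero]
    funext x
    simp only [row, Pi.add_apply, Pi.smul_apply, smul_eq_mul]
    rw [hentry, hd₀]
    ring
  · refine ⟨0, 0, fun t d => ?_⟩
    rw [smul_zero, add_zero]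
    refine congrFun (row_eq_of_kernel_eq (kernel_congr ?_) T) d
    ext p q
    rcases q with i | e
    · simp
    · simp only [coefMatrix_inr, ofPoint, ofCoeff_k, Function.update_apply, Prod.mk.injEq]
      by_cases h : p = d₀ ∧ e = e₀
      · obtain ⟨rfl, rfl⟩ := h
        simp [hadj]
      · simp [h]

theorem eq_of_not_linearIndepOn_row_update {a : (Fin n ⊕ E) × E → K} {T : Finset V}
    {X : Set (Fin n ⊕ E)} (h : LinearIndepOn K ((ofPoint G a).row T) X) (i : (Fin n ⊕ E) × E)
    {x y : K} (hx : ¬ LinearIndepOn K ((ofPoint G (Function.update a i x)).row T) X)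
    (hy : ¬ LinearIndepOn K ((ofPoint G (Function.update a i y)).row T) X) : x = y := by
  classical
  obtain ⟨d₀, e₀⟩ := i
  obtain ⟨u, r, hur⟩ := row_ofPoint_update G a d₀ e₀ T
  have := eq_of_not_linearIndependent_add_smul (x := x - a (d₀, e₀)) (y := y - a (d₀, e₀))
    h (fun d : X => u d) r
  simp only [LinearIndepOn, hur] at hx hy
  exact sub_left_injective (this hx hy)

end Update

section Change

variable {G : Network V E} {F : Type*} {K : Type w} [Field F] [Field K] [Algebra F K] {n m : ℕ}

/-- The image in `K` of the kernels over `F` satisfies the same recursion, hence is the code over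
`K`; and linear independence is insensitive to field extension. -/
theorem linearIndepOn_row_ofPoint_algebraMap (b : (Fin n ⊕ E) × E → F) (T : Finset V)
    (X : Set (Fin n ⊕ E)) :
    LinearIndepOn K ((ofPoint G fun i => algebraMap F K (b i)).row T) X ↔
      LinearIndepOn F ((ofPoint G b).row T) X := by
  let c : G.Code K n :=
    { k := fun d e => algebraMap F K (b (d, e))
      kernel := fun x d => algebraMap F K ((ofPoint G b).kernel x d)
      kernel_message := by
        intro i
        funext d
        simp [(ofPoint G b).kernel_message, Pi.single_apply, apply_ite (algebraMap F K)]
      kernel_channel := by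
        intro e
        funext d
        rw [(ofPoint G b).kernel_channel]
        simp [Pi.single_apply, apply_ite (algebraMap F K), ofPoint, Algebra.smul_def] }
  have hc : (ofPoint G fun i => algebraMap F K (b i)).row T = c.row T :=
    row_eq_of_kernel_eq (c' := c) (kernel_congr (c' := c) (by rfl)) T
  rw [hc]
  exact linearIndependent_algebraMap_comp_iff (S := K) (v := fun d : X => (ofPoint G b).row T d)

/-- Relabelling of the messages. -/
theorem exists_row_relabel (c : G.Code K n) (σ : Fin m → Fin n) (T : Finset V) :
    ∃ c' : G.Code K m, ∀ d, c'.row T d = c.row T (Sum.map σ id d) := by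
  -- `σ` need not be injective: error rows never depend on the message coefficients.
  let c' : G.Code K m := ofCoeff G fun d e => c.k (Sum.map σ id d) e
  refine ⟨c', ?_⟩
  obtain ⟨pos, hpos, -⟩ := G.exists_topological_order m
  have hext : ∀ d : Fin m ⊕ E, G.extHead n (Sum.map σ id d) = G.extHead m d := by
    rintro (i | e) <;> rfl
  have key : ∀ N d, (∀ e, pos (Sum.inr e) ≤ pos d + N) →
      c'.row T d = c.row T (Sum.map σ id d) := by
    intro N
    induction N using Nat.strong_induction_on with
    | _ N ih =>
      intro d hd
      rw [c'.row_eq, c.row_eq]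
      congr 1
      · funext e
        rcases d with i | e' <;> simp
      · refine Finset.sum_congr rfl fun e _ => ?_
        rw [hext]
        split_ifs with h
        · have h1 := hpos d e h
          have h2 := hd e
          rw [ih (N - 1) (by omega) (Sum.inr e)]
          · rfl
          · intro e'
            have := hd e'
            omega
        · simp
  intro d
  obtain ⟨B, hB⟩ := (Set.finite_range fun e : E => pos (Sum.inr e)).bddAbove
  exact key B d fun e => (hB ⟨e, rfl⟩).trans (Nat.le_add_left _ _)

/-- The point of the coefficients of a code. -/
theorem exists_row_ofPoint (c : G.Code K n) :
    ∃ a : (Fin n ⊕ E) × E → K, ∀ T, (ofPoint G a).row T = c.row T :=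
  ⟨fun i => c.k i.1 i.2, row_eq_of_kernel_eq c.ofCoeff_k_kernel⟩

end Change

section Generic

variable (G : Network V E) (K : Type w) [Field K] [Infinite K] (n : ℕ)

/-- There is a code whose rows are independent wherever those of some code are. -/
theorem exists_generic (T : Finset V) : ∃ g : G.Code K n, ∀ X : Set (Fin n ⊕ E),
    ∀ c : G.Code K n, LinearIndepOn K (c.row T) X → LinearIndepOn K (g.row T) X := by
  classical
  let J := {X : Set (Fin n ⊕ E) // ∃ c : G.Code K n, LinearIndepOn K (c.row T) X}
  have : Fintype J := Fintype.ofFinite J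
  obtain ⟨b, hb⟩ := exists_common_point (F := K) (K := K) (J := J) (by simp)
    (fun X a => LinearIndepOn K ((ofPoint G a).row T) X.1)
    (fun X a ha i x y hx hy => eq_of_not_linearIndepOn_row_update G ha i hx hy)
    (by
      rintro ⟨X, c, hc⟩
      obtain ⟨a, ha⟩ := c.exists_row_ofPoint
      exact ⟨a, by rwa [ha]⟩)
  exact ⟨ofPoint G b, fun X c hc => hb ⟨X, c, hc⟩⟩

end Generic

end Code

end Network

end LNEC

/-! ### Max-flow min-cut by kernels in general position -/

namespace LNEC

theorem finrank_span_image_of_linearIndepOn {ι K M : Type*} [Field K] [AddCommGroup M] [Module K M]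
    {f : ι → M} {s : Finset ι} (h : LinearIndepOn K f (s : Set ι)) :
    Module.finrank K (Submodule.span K (f '' (s : Set ι))) = s.card := by
  rw [Set.image_eq_range]
  have := finrank_span_eq_card (R := K) (b := fun x : (s : Set ι) => f x) h
  rw [this]
  simp

/-- A vector of `W` that lies in no submodule of a finite family unless it contains `W`. -/
theorem exists_mem_forall_mem_imp_le {ι K M : Type*} [Finite ι] [Field K] [Infinite K]
    [AddCommGroup M] [Module K M] (W : Submodule K M) (S : ι → Submodule K M) :
    ∃ x ∈ W, ∀ j, x ∈ S j → W ≤ S j := by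
  -- A vector space over an infinite field is not a finite union of proper subspaces.
  obtain ⟨x, hx⟩ := Submodule.exists_forall_notMem_of_forall_ne_top
    (fun j : {j // ¬ W ≤ S j} => (S j).comap W.subtype)
    (fun j h => j.2 (Submodule.comap_subtype_eq_top.1 h))
  refine ⟨x, x.2, fun j hj => ?_⟩
  by_contra hW
  exact hx ⟨j, hW⟩ hj

namespace Network

variable {V : Type u} {E : Type v}

/-- Every path from `In(s)` that ends with the given channel meets `A`. -/
inductive Covers (G : Network V E) {n : ℕ} (A : Finset (Fin n ⊕ E)) : Fin n ⊕ E → Prop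
  | mem {d : Fin n ⊕ E} : d ∈ A → Covers G A d
  | step {e : E} : (∀ d, G.extHead n d = G.tail e → Covers G A d) → Covers G A (Sum.inr e)

/-- Either `A` contains all `n` messages, or it misses one; in the second case a path avoiding the
real channels of `A` would carry that message to `T` uncovered, so these channels form a cut. -/
theorem min_minCut_le_card_of_covers (G : Network V E) {n : ℕ} {A : Finset (Fin n ⊕ E)}
    {T : Finset V} (hT : G.source ∉ T) (hA : ∀ e, G.head e ∈ T → G.Covers A (Sum.inr e)) :
    min n (G.minCut T) ≤ A.card := by
  classical
  by_contra! hlt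
  obtain ⟨hn, hcut⟩ := lt_min_iff.1 hlt
  obtain ⟨i, hi⟩ : ∃ i : Fin n, Sum.inl i ∉ A := by
    by_contra! h
    have h1 : (Finset.univ.map (Function.Embedding.inl : Fin n ↪ Fin n ⊕ E)) ⊆ A := by
      intro x hx
      obtain ⟨i, -, rfl⟩ := Finset.mem_map.1 hx
      exact h i
    have h2 := Finset.card_le_card h1
    simp at h2
    omega
  have key : ∀ x, G.Reaches A.toRight x → ∃ d, G.extHead n d = x ∧ ¬ G.Covers A d := by
    intro x hx
    induction hx with
    | refl =>
      refine ⟨Sum.inl i, rfl, fun h => ?_⟩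
      cases h with
      | mem h => exact hi h
    | tail _ h ih =>
      obtain ⟨e, he, rfl, rfl⟩ := h
      obtain ⟨d, hd, hdA⟩ := ih
      refine ⟨Sum.inr e, rfl, fun h => ?_⟩
      cases h with
      | mem h => exact he (by simpa using h)
      | step h => exact hdA (h d hd)
  have hc : G.IsCut T A.toRight := by
    intro t ht hr
    obtain ⟨d, hd, hdA⟩ := key t hr
    rcases d with j | e
    · exact hT (by rw [show G.source = t from hd]; exact ht)
    · exact hdA (hA e (by rw [show G.head e = t from hd]; exact ht))
  have h1 : G.minCut T ≤ A.toRight.card := Nat.sInf_le ⟨_, hc, rfl⟩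
  have h2 : A.toRight.card ≤ A.card := Finset.card_toRight_le
  omega

variable [Fintype E] [DecidableEq V] [DecidableEq E] (G : Network V E)
  (K : Type w) [Field K] [Infinite K] (n : ℕ)

omit [DecidableEq E] in
/-- Global encoding kernels in general position, with respect to a numbering of the channels. -/
theorem exists_generic_vectors (pos : Fin n ⊕ E → ℕ)
    (hpos : ∀ d e, G.extHead n d = G.tail e → pos d < pos (Sum.inr e)) :
    ∃ f : Fin n ⊕ E → (Fin n → K), (∀ i, f (Sum.inl i) = Pi.single i 1) ∧
      ∀ e, f (Sum.inr e) ∈ Submodule.span K (f '' (G.inChannels n (G.tail e) : Set _)) ∧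
        ∀ Y : Finset (Fin n ⊕ E), (∀ d, Sum.inr d ∈ Y → pos (Sum.inr d) < pos (Sum.inr e)) →
          f (Sum.inr e) ∈ Submodule.span K (f '' (Y : Set _)) →
          Submodule.span K (f '' (G.inChannels n (G.tail e) : Set _)) ≤
            Submodule.span K (f '' (Y : Set _)) := by
  classical
  choose pick hpick hpick' using fun (g : Fin n ⊕ E → (Fin n → K)) (e : E) =>
    exists_mem_forall_mem_imp_le
      (Submodule.span K (g '' (G.inChannels n (G.tail e) : Set (Fin n ⊕ E))))
      (fun Y : Finset (Fin n ⊕ E) => Submodule.span K (g '' (Y : Set (Fin n ⊕ E))))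
  let msg : Fin n → (Fin n → K) := fun i => Pi.single i 1
  let wf := (measure fun e : E => pos (Sum.inr e)).wf
  -- `pick` wants vectors for all channels; those not yet treated get the default `0`, which by
  -- `himg` is never seen by the spans in question.
  let f₀ : E → (Fin n → K) := wf.fix fun e ih => pick (Sum.elim msg fun d =>
    if h : pos (Sum.inr d) < pos (Sum.inr e) then ih d h else 0) e
  have hf₀ : ∀ e, f₀ e = pick (Sum.elim msg fun d =>
      if pos (Sum.inr d) < pos (Sum.inr e) then f₀ d else 0) e := by
    intro e
    have := wf.fix_eq (fun e ih => pick (Sum.elim msg fun d =>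
      if h : pos (Sum.inr d) < pos (Sum.inr e) then ih d h else 0) e) e
    refine this.trans ?_
    congr 2
  have himg : ∀ (e : E) (Y : Finset (Fin n ⊕ E)),
      (∀ d, Sum.inr d ∈ Y → pos (Sum.inr d) < pos (Sum.inr e)) →
      (Sum.elim msg fun d => if pos (Sum.inr d) < pos (Sum.inr e) then f₀ d else 0) ''
        (Y : Set (Fin n ⊕ E)) = Sum.elim msg f₀ '' (Y : Set (Fin n ⊕ E)) := by
    intro e Y hY
    refine Set.image_congr fun x hx => ?_
    rcases x with i | d
    · rfl
    · simp [hY d hx]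
  have hin : ∀ e d, Sum.inr d ∈ G.inChannels n (G.tail e) →
      pos (Sum.inr d) < pos (Sum.inr e) := by
    intro e d hd
    exact hpos _ _ (by simpa [inChannels] using hd)
  refine ⟨Sum.elim msg f₀, fun i => rfl, fun e => ⟨?_, fun Y hY h => ?_⟩⟩
  · rw [← himg e _ (hin e), Sum.elim_inr, hf₀ e]
    exact hpick _ e
  · rw [← himg e _ (hin e), ← himg e Y hY]
    rw [← himg e Y hY, Sum.elim_inr, hf₀ e] at h
    exact hpick' _ e Y h

/-- Max-flow min-cut, in terms of codes. -/
theorem exists_code_min_le_finrank_messageSpace {T : Finset V} (hT : G.source ∉ T) :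
    ∃ c : G.Code K n, min n (G.minCut T) ≤ Module.finrank K (c.messageSpace T) := by
  classical
  obtain ⟨pos, hpos, hinj⟩ := G.exists_topological_order n
  obtain ⟨f, hmsg, hf⟩ := G.exists_generic_vectors K n pos hpos
  -- The dimension bounds the size of a cover. Remove the latest channel `e` of `X`. If its vector
  -- lies in the span of the rest, general position puts all inputs of `e` in that span, so `e` may
  -- be traded for them. Otherwise the dimension drops by one and `e` itself joins the cover.
  have key : ∀ m, ∀ X : Finset (Fin n ⊕ E), (∀ e, Sum.inr e ∈ X → pos (Sum.inr e) < m) →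
      ∃ A : Finset (Fin n ⊕ E),
        A.card ≤ Module.finrank K (Submodule.span K (f '' (X : Set (Fin n ⊕ E)))) ∧
        ∀ x ∈ X, G.Covers A x := by
    intro m
    induction m with
    | zero =>
      intro X hX
      refine ⟨X, ?_, fun x hx => .mem hx⟩
      rw [finrank_span_image_of_linearIndepOn]
      have h1 : LinearIndependent K (f ∘ (Sum.inl : Fin n → Fin n ⊕ E)) := by
        have h2 : f ∘ (Sum.inl : Fin n → Fin n ⊕ E) = Pi.basisFun K (Fin n) := by
          funext i
          simp [hmsg]
        rw [h2]
        exact (Pi.basisFun K (Fin n)).linearIndependent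
      refine ((linearIndepOn_range_iff Sum.inl_injective f).2 h1).mono ?_
      rintro (i | e) hx
      · exact ⟨i, rfl⟩
      · exact absurd (hX e hx) (Nat.not_lt_zero _)
    | succ m ih =>
      intro X hX
      by_cases h : ∃ e, Sum.inr e ∈ X ∧ pos (Sum.inr e) = m
      · obtain ⟨e, he, hem⟩ := h
        have hY : ∀ d, Sum.inr d ∈ X.erase (Sum.inr e) → pos (Sum.inr d) < m := by
          intro d hd
          have h1 := hX d (Finset.mem_of_mem_erase hd)
          have h2 : pos (Sum.inr d) ≠ m := by
            intro h
            have := hinj d e (h.trans hem.symm)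
            subst this
            simp at hd
          omega
        have hXY : (X : Set (Fin n ⊕ E)) = insert (Sum.inr e) (X.erase (Sum.inr e) : Set _) := by
          rw [← Finset.coe_insert, Finset.insert_erase he]
        by_cases hmem : f (Sum.inr e) ∈
            Submodule.span K (f '' (X.erase (Sum.inr e) : Finset (Fin n ⊕ E)))
        · have hle := (hf e).2 _ (by rw [hem]; exact hY) hmem
          obtain ⟨A, hA, hcov⟩ := ih (X.erase (Sum.inr e) ∪ G.inChannels n (G.tail e)) (by
            intro d hd
            rcases Finset.mem_union.1 hd with hd | hd
            · exact hY d hd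
            · rw [← hem]
              exact hpos _ _ (by simpa [inChannels] using hd))
          refine ⟨A, hA.trans (Submodule.finrank_mono ?_), fun x hx => ?_⟩
          · rw [Finset.coe_union, Set.image_union, Submodule.span_union]
            refine (sup_le le_rfl hle).trans (Submodule.span_mono (Set.image_mono ?_))
            exact Finset.coe_subset.2 (Finset.erase_subset _ _)
          · by_cases hxe : x = Sum.inr e
            · subst hxe
              exact .step fun d hd => hcov d
                (Finset.mem_union_right _ (by simpa [inChannels] using hd))
            · exact hcov x (Finset.mem_union_left _ (Finset.mem_erase.2 ⟨hxe, hx⟩))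
        · obtain ⟨A, hA, hcov⟩ := ih _ hY
          refine ⟨insert (Sum.inr e) A, ?_, fun x hx => ?_⟩
          · refine (Finset.card_insert_le _ _).trans (Nat.succ_le_of_lt (hA.trans_lt ?_))
            refine Submodule.finrank_lt_finrank_of_lt (lt_of_le_of_ne ?_ ?_)
            · exact Submodule.span_mono (Set.image_mono
                (Finset.coe_subset.2 (Finset.erase_subset _ _)))
            · intro heq
              rw [heq] at hmem
              exact hmem (Submodule.subset_span ⟨_, he, rfl⟩)
          · by_cases hxe : x = Sum.inr e
            · subst hxe
              exact .mem (Finset.mem_insert_self _ _)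
            · have hsub : ∀ y, G.Covers A y → G.Covers (insert (Sum.inr e) A) y := by
                intro y hy
                induction hy with
                | mem h => exact .mem (Finset.mem_insert_of_mem h)
                | step _ ih => exact .step ih
              exact hsub x (hcov x (Finset.mem_erase.2 ⟨hxe, hx⟩))
      · refine ih X fun e he => ?_
        have h1 := hX e he
        have h2 : pos (Sum.inr e) ≠ m := fun h' => h ⟨e, he, h'⟩
        omega
  have hk : ∀ e, ∃ k : Fin n ⊕ E → K,
      ∑ d ∈ G.inChannels n (G.tail e), k d • f d = f (Sum.inr e) := by
    intro e
    obtain ⟨k, hk⟩ := (Submodule.mem_span_image_finset_iff_exists_fun K).1 (hf e).1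
    refine ⟨fun d => if h : d ∈ G.inChannels n (G.tail e) then k ⟨d, h⟩ else 0, ?_⟩
    rw [← hk, ← Finset.sum_coe_sort]
    simp
  choose k hk using hk
  let c : G.Code K n := Code.ofCoeff G fun d e => k e d
  have hker : ∀ m x, pos x < m → ∀ i, c.kernel x (Sum.inl i) = f x i := by
    intro m
    induction m with
    | zero => intro x hx; omega
    | succ m ih =>
      rintro (j | e) hx i
      · rw [c.kernel_message, hmsg, Pi.single_apply, Pi.single_apply]
        simp
      · rw [c.kernel_channel, ← hk e]
        simp only [Pi.add_apply, Finset.sum_apply, Pi.smul_apply, smul_eq_mul]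
        rw [Pi.single_eq_of_ne (by simp), add_zero]
        refine Finset.sum_congr rfl fun d hd => ?_
        have h1 := hpos d e (by simpa [inChannels] using hd)
        rw [ih d (by omega) i]
        rfl
  refine ⟨c, ?_⟩
  let X : Finset (Fin n ⊕ E) :=
    (Finset.univ.filter fun e => G.head e ∈ T).map Function.Embedding.inr
  obtain ⟨B, hB⟩ := (Set.finite_range fun e : E => pos (Sum.inr e)).bddAbove
  obtain ⟨A, hA, hcov⟩ := key (B + 1) X fun e _ => Nat.lt_succ_of_le (hB ⟨e, rfl⟩)
  refine (G.min_minCut_le_card_of_covers hT fun e he => hcov _ (by simpa [X] using he)).trans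
    (hA.trans (le_of_eq ?_))
  -- The message space is the row space of `M`, the generic vectors its columns; the two spans have
  -- equal dimension.
  let M : Matrix (Fin n) {e : E // G.head e ∈ T} K :=
    Matrix.of fun i => c.row T (Sum.inl i)
  have h1 := M.rank_eq_finrank_span_row
  have h2 := M.rank_eq_finrank_span_cols
  rw [h1] at h2
  have h3 : c.messageSpace T = Submodule.span K (Set.range M.row) := rfl
  rw [h3, h2]
  have h4 : f '' (X : Set (Fin n ⊕ E)) = Set.range M.col := by
    ext y
    simp only [X, Set.mem_image, Finset.mem_coe, Finset.mem_map, Finset.mem_filter,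
      Finset.mem_univ, true_and, Set.mem_range]
    constructor
    · rintro ⟨_, ⟨e, he, rfl⟩, rfl⟩
      exact ⟨⟨e, he⟩, funext fun i => hker _ _ (Nat.lt_succ_self _) i⟩
    · rintro ⟨⟨e, he⟩, rfl⟩
      exact ⟨Sum.inr e, ⟨e, he, rfl⟩, funext fun i => (hker _ _ (Nat.lt_succ_self _) i).symm⟩
  rw [h4]

end Network

end LNEC

/-! ### Cuts of the enlarged network, and restriction of its codes -/

namespace LNEC

namespace Network

section MinCut

variable {V : Type u} {E : Type v}

theorem isCut_univ [Fintype E] (G : Network V E) {T : Finset V} (hT : G.source ∉ T) :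
    G.IsCut T Finset.univ := by
  intro t ht h
  rcases Relation.ReflTransGen.cases_tail h with h | ⟨x, -, e, he, -⟩
  · exact hT (h ▸ ht)
  · exact he (Finset.mem_univ e)

theorem exists_isCut_card_eq_minCut [Fintype E] (G : Network V E) {T : Finset V}
    (hT : G.source ∉ T) : ∃ A : Finset E, G.IsCut T A ∧ A.card = G.minCut T := by
  exact Nat.sInf_mem (s := {n | ∃ A : Finset E, G.IsCut T A ∧ A.card = n})
    ⟨_, Finset.univ, G.isCut_univ hT, rfl⟩

/-- A cut of `t_T` becomes a cut of `T` of no greater size: wherever it contains all `C_t` new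
channels from `t`, these are replaced by a minimum cut of `t`. Any other `t` is already cut off by
the old channels. -/
theorem minCut_le_minCut_enlarged [Fintype V] [Fintype E] [DecidableEq V] [DecidableEq E]
    (G : Network V E) (T : G.Coll) : G.minCut T.1 ≤ G.enlarged.minCut {Sum.inr T} := by
  classical
  obtain ⟨B, hB, hBcard⟩ := G.enlarged.exists_isCut_card_eq_minCut (T := {Sum.inr T})
    (by simp [enlarged])
  rw [← hBcard]
  have hcut : ∀ t : {t : V // t ∈ T.1}, ∃ A : Finset E, G.IsCut {t.1} A ∧
      A.card = G.minCut {t.1} := by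
    intro t
    exact G.exists_isCut_card_eq_minCut fun h =>
      T.2.2 (Eq.mpr (congrArg (· ∈ T.1) (Finset.mem_singleton.1 h)) t.2)
  choose A hA hAcard using hcut
  let S : Finset {t : V // t ∈ T.1} :=
    Finset.univ.filter fun t => ∀ j : Fin (G.minCut {t.1}), Sum.inr ⟨T, t, j⟩ ∈ B
  let new : (Σ t : {t : V // t ∈ T.1}, Fin (G.minCut {t.1})) ↪ G.NewChannel :=
    ⟨fun x => ⟨T, x⟩, fun _ _ h => by simpa using h⟩
  have hS : ∑ t ∈ S, G.minCut {t.1} ≤ B.toRight.card := by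
    have h1 : (S.sigma fun t => (Finset.univ : Finset (Fin (G.minCut {t.1})))).map new ⊆
        B.toRight := by
      intro x hx
      obtain ⟨⟨t, j⟩, hy, rfl⟩ := Finset.mem_map.1 hx
      have h2 : t ∈ S := (Finset.mem_sigma.1 hy).1
      exact Finset.mem_toRight.2 ((Finset.mem_filter.1 h2).2 j)
    have h2 := Finset.card_le_card h1
    simpa [Finset.card_sigma] using h2
  have hreach : ∀ x, G.Reaches (B.toLeft ∪ S.biUnion A) x →
      G.enlarged.Reaches B (Sum.inl x) := by
    intro x hx
    induction hx with
    | refl => exact .refl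
    | tail _ h ih =>
      obtain ⟨e, he, rfl, rfl⟩ := h
      exact ih.tail ⟨Sum.inl e, fun h => he (Finset.mem_union_left _ (Finset.mem_toLeft.2 h)),
        rfl, rfl⟩
  have hC : G.IsCut T.1 (B.toLeft ∪ S.biUnion A) := by
    intro t ht hr
    by_cases htS : (⟨t, ht⟩ : {t : V // t ∈ T.1}) ∈ S
    · refine hA ⟨t, ht⟩ t (Finset.mem_singleton_self t) (Relation.ReflTransGen.mono ?_ _ _ hr)
      rintro a b ⟨e, he, h⟩
      exact ⟨e, fun h' => he (Finset.mem_union_right _ (Finset.mem_biUnion.2 ⟨_, htS, h'⟩)), h⟩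
    · have h1 : ∃ j : Fin (G.minCut {t}), Sum.inr ⟨T, ⟨t, ht⟩, j⟩ ∉ B := by
        simpa [S] using htS
      obtain ⟨j, hj⟩ := h1
      exact hB (Sum.inr T) (Finset.mem_singleton_self _)
        ((hreach t hr).tail ⟨Sum.inr ⟨T, ⟨t, ht⟩, j⟩, hj, rfl, rfl⟩)
  calc G.minCut T.1 ≤ (B.toLeft ∪ S.biUnion A).card := Nat.sInf_le ⟨_, hC, rfl⟩
    _ ≤ B.toLeft.card + ∑ t ∈ S, (A t).card :=
      (Finset.card_union_le _ _).trans (Nat.add_le_add_left Finset.card_biUnion_le _)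
    _ = B.toLeft.card + ∑ t ∈ S, G.minCut {t.1} := by simp only [hAcard]
    _ ≤ B.toLeft.card + B.toRight.card := Nat.add_le_add_left hS _
    _ = B.card := Finset.card_toLeft_add_card_toRight

end MinCut

namespace Code

section Restrict

variable {V : Type u} {E : Type v} [Fintype V] [Fintype E] [DecidableEq V] [DecidableEq E]
  {G : Network V E} {K : Type w} [Field K] {n : ℕ}

variable (G n) in
/-- The inclusion of the channels of `G` in those of the enlarged network. -/
def enlargedChannel : Fin n ⊕ E → Fin n ⊕ (E ⊕ G.NewChannel) := Sum.map id Sum.inl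

omit [Fintype V] [DecidableEq E] in
theorem sum_inChannels {M : Type*} [AddCommMonoid M] (G : Network V E) (x : V)
    (f : Fin n ⊕ E → M) :
    ∑ d ∈ G.inChannels n x, f d = (∑ i, if G.source = x then f (Sum.inl i) else 0) +
      ∑ e, if G.head e = x then f (Sum.inr e) else 0 := by
  rw [inChannels, Finset.sum_filter, Fintype.sum_sum_type]
  rfl

omit [DecidableEq E] in
theorem sum_inChannels_enlarged {M : Type*} [AddCommMonoid M] (x : V)
    (f : Fin n ⊕ (E ⊕ G.NewChannel) → M) :
    ∑ d ∈ G.enlarged.inChannels n (Sum.inl x), f d =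
      ∑ d ∈ G.inChannels n x, f (enlargedChannel G n d) := by
  rw [sum_inChannels, sum_inChannels, Fintype.sum_sum_type]
  simp only [enlarged, enlargedHead, enlargedChannel, Sum.inl.injEq, Sum.elim_inl, Sum.elim_inr,
    reduceCtorEq, if_false, Finset.sum_const_zero, add_zero, Sum.map_inl, Sum.map_inr, id]

/-- The restriction to `G` of a code on the enlarged network. -/
def restrict (c : G.enlarged.Code K n) : G.Code K n where
  k := fun d e => c.k (enlargedChannel G n d) (Sum.inl e)
  kernel := fun d x => c.kernel (enlargedChannel G n d) (enlargedChannel G n x)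
  kernel_message := by
    intro i
    funext x
    have h := congrFun (c.kernel_message i) (enlargedChannel G n x)
    refine h.trans ?_
    rcases x with j | e <;> simp [enlargedChannel, Pi.single_apply]
  kernel_channel := by
    intro e
    funext x
    have h := congrFun (c.kernel_channel (Sum.inl e)) (enlargedChannel G n x)
    refine h.trans ?_
    have h1 : G.enlarged.tail (Sum.inl e) = Sum.inl (G.tail e) := rfl
    rw [h1, sum_inChannels_enlarged]
    simp only [Pi.add_apply, Finset.sum_apply, Pi.smul_apply]
    congr 1
    rcases x with j | e' <;> simp [enlargedChannel, Pi.single_apply]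

/-- What arrives at the new node `t_T` is a linear function of what arrives at `T`. -/
theorem exists_linearMap_row_restrict (c : G.enlarged.Code K n) (T : G.Coll) :
    ∃ L : ({e : E // G.head e ∈ T.1} → K) →ₗ[K]
        ({e : E ⊕ G.NewChannel // G.enlarged.head e ∈ ({Sum.inr T} : Finset (V ⊕ G.Coll))} → K),
      ∀ d, L (c.restrict.row T.1 d) = c.row {Sum.inr T} (enlargedChannel G n d) := by
  classical
  let N : Matrix {e : E ⊕ G.NewChannel //
      G.enlarged.head e ∈ ({Sum.inr T} : Finset (V ⊕ G.Coll))} {e : E // G.head e ∈ T.1} K :=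
    Matrix.of fun x e => if Sum.inl (G.head e.1) = G.enlarged.tail x.1 then
      c.k (Sum.inr (Sum.inl e.1)) x.1 else 0
  refine ⟨N.mulVecLin, fun d => ?_⟩
  funext x
  obtain ⟨x, hx⟩ := x
  rcases x with e | ⟨T', t, j⟩
  · exact absurd (Finset.mem_singleton.1 hx) (by simp [enlarged, enlargedHead])
  · have hT : T' = T := Sum.inr_injective (Finset.mem_singleton.1 hx)
    subst hT
    have h := congrFun (c.kernel_channel (Sum.inr ⟨T', t, j⟩)) (enlargedChannel G n d)
    have h1 : G.enlarged.tail (Sum.inr ⟨T', t, j⟩) = Sum.inl t.1 := rfl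
    have h2 : (Pi.single (Sum.inr (Sum.inr ⟨T', t, j⟩)) (1 : K) :
        Fin n ⊕ (E ⊕ G.NewChannel) → K) (enlargedChannel G n d) = 0 := by
      rcases d with i | e <;> simp [enlargedChannel]
    rw [h1, sum_inChannels_enlarged, Pi.add_apply, h2, add_zero, Finset.sum_apply] at h
    refine Eq.trans ?_ h.symm
    have hs : G.source ≠ t.1 := fun h => T'.2.2 (Eq.mpr (congrArg (· ∈ T'.1) h) t.2)
    rw [sum_inChannels]
    simp only [if_neg hs, Finset.sum_const_zero, zero_add, Matrix.mulVecLin_apply, Matrix.mulVec,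
      dotProduct, N, Matrix.of_apply, h1, Sum.inl.injEq]
    have h3 : ∀ e, G.head e ∉ T'.1 → (if G.head e = t.1 then
        (c.k (enlargedChannel G n (Sum.inr e)) (Sum.inr ⟨T', ⟨t, j⟩⟩) •
          c.kernel (enlargedChannel G n (Sum.inr e))) (enlargedChannel G n d) else 0) = 0 := by
      intro e he
      exact if_neg fun h => he (Eq.mpr (congrArg (· ∈ T'.1) h) t.2)
    rw [← Finset.sum_subset (Finset.subset_univ (Finset.univ.filter fun e => G.head e ∈ T'.1))
      (fun e _ he => h3 e (by simpa using he)),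
      Finset.sum_subtype (p := fun e => G.head e ∈ T'.1) _ (by simp)]
    refine Finset.sum_congr rfl fun e _ => ?_
    rw [ite_mul, zero_mul]
    rfl

end Restrict

end Code

end Network

end LNEC

/-! ### Rank, Singleton bound, and exchange of messages and errors -/

namespace LNEC

theorem finrank_span_image_le_card {ι K M : Type*} [Field K] [AddCommGroup M] [Module K M]
    (f : ι → M) (s : Finset ι) :
    Module.finrank K (Submodule.span K (f '' (s : Set ι))) ≤ s.card := by
  classical
  rw [← Finset.coe_image]
  exact (finrank_span_finset_le_card _).trans Finset.card_image_le

theorem exists_linearIndepOn_finset_extension {ι K M : Type*} [Field K] [AddCommGroup M]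
    [Module K M] {f : ι → M} {s t : Finset ι} (hs : LinearIndepOn K f (s : Set ι)) (hst : s ⊆ t) :
    ∃ b : Finset ι, s ⊆ b ∧ b ⊆ t ∧ LinearIndepOn K f (b : Set ι) ∧
      Submodule.span K (f '' (b : Set ι)) = Submodule.span K (f '' (t : Set ι)) := by
  obtain ⟨b, hbt, hsb, hspan, hb⟩ := exists_linearIndepOn_extension hs (Finset.coe_subset.2 hst)
  have hfin : b.Finite := t.finite_toSet.subset hbt
  lift b to Finset ι using hfin
  exact ⟨b, Finset.coe_subset.1 hsb, Finset.coe_subset.1 hbt, hb,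
    le_antisymm (Submodule.span_mono (Set.image_mono hbt)) (Submodule.span_le.2 hspan)⟩

namespace Network

namespace Code

section Rows

variable {V : Type u} {E : Type v} [Fintype E] [DecidableEq V] [DecidableEq E]
  {G : Network V E} {K : Type w} [Field K] {n : ℕ}

theorem messageSpace_eq_span_image (c : G.Code K n) (T : Finset V) :
    c.messageSpace T = Submodule.span K (c.row T '' Set.range Sum.inl) := by
  rw [← Set.range_comp]
  rfl

theorem errorSpace_eq_span_image (c : G.Code K n) (T : Finset V) (ρ : Finset E) :
    c.errorSpace T ρ = Submodule.span K (c.row T '' (Sum.inr '' (ρ : Set E))) := by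
  rw [Set.image_image]
  rfl

theorem errorSpace_mono (c : G.Code K n) (T : Finset V) {ρ₁ ρ₂ : Finset E} (h : ρ₁ ⊆ ρ₂) :
    c.errorSpace T ρ₁ ≤ c.errorSpace T ρ₂ :=
  Submodule.span_mono (Set.image_mono (Finset.coe_subset.2 h))

theorem finrank_errorSpace_le_card (c : G.Code K n) (T : Finset V) (ρ : Finset E) :
    Module.finrank K (c.errorSpace T ρ) ≤ ρ.card :=
  finrank_span_image_le_card _ ρ

theorem finrank_errorSpace_le_errorRank (c : G.Code K n) (T : Finset V) (ρ : Finset E) :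
    Module.finrank K (c.errorSpace T ρ) ≤ errorRank.{w} G T ρ := by
  obtain ⟨ρ', hdom, hcard⟩ := Nat.sInf_mem
    (s := {m | ∃ ρ' : Finset E, Dominated.{w} G T ρ ρ' ∧ ρ'.card = m})
    ⟨_, ρ, fun _ _ _ _ => le_rfl, rfl⟩
  exact (Submodule.finrank_mono (hdom K n c)).trans
    ((c.finrank_errorSpace_le_card T ρ').trans hcard.le)

theorem errorRank_le_card (G : Network V E) (T : Finset V) (ρ : Finset E) :
    errorRank.{w} G T ρ ≤ ρ.card :=
  Nat.sInf_le ⟨ρ, fun _ _ _ _ => le_rfl, rfl⟩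

/-- One code certifies full rank, since domination is demanded in every code. -/
theorem mem_fullRankPatterns (c : G.Code K n) {T : Finset V} {ρ : Finset E}
    (h : LinearIndepOn K (fun e => c.row T (Sum.inr e)) (ρ : Set E)) :
    ρ ∈ fullRankPatterns.{w} G T ρ.card := by
  refine ⟨rfl, le_antisymm (errorRank_le_card G T ρ) ?_⟩
  have h1 : Module.finrank K (c.errorSpace T ρ) = ρ.card := finrank_span_image_of_linearIndepOn h
  exact h1.symm.le.trans (c.finrank_errorSpace_le_errorRank T ρ)

/-- Dimension, rank and cardinality increase in this order, so a lower bound on the first and a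
pattern attaining it in the last squeeze all three minima. -/
theorem hasMinDistance_of_le (c : G.Code K n) {T : Finset V} {d : ℕ}
    (hle : ∀ ρ ∈ c.confusable T, d ≤ Module.finrank K (c.errorSpace T ρ))
    (hex : ∃ ρ ∈ c.confusable T, ρ.card ≤ d) : c.HasMinDistance T d := by
  obtain ⟨ρ, hρ, hcard⟩ := hex
  have h1 := hle ρ hρ
  have h2 := c.finrank_errorSpace_le_errorRank T ρ
  have h3 := errorRank_le_card.{w} G T ρ
  refine ⟨⟨⟨ρ, hρ, by omega⟩, ?_⟩, ⟨⟨ρ, hρ, by omega⟩, ?_⟩, ⟨⟨ρ, hρ, by simp only; omega⟩, ?_⟩⟩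
  · rintro _ ⟨ρ', hρ', rfl⟩
    exact (hle ρ' hρ').trans (c.finrank_errorSpace_le_errorRank T ρ')
  · rintro _ ⟨ρ', hρ', rfl⟩
    exact (hle ρ' hρ').trans (c.finrank_errorSpace_le_card T ρ')
  · rintro _ ⟨ρ', hρ', rfl⟩
    exact hle ρ' hρ'

/-- The Singleton bound. -/
theorem exists_confusable_card_le (c : G.Code K n) {T : Finset V} {A : Finset E}
    (hA : G.IsCut T A) (hpos : 0 < Module.finrank K (c.messageSpace T)) :
    ∃ ρ ∈ c.confusable T, ρ.card ≤ A.card - Module.finrank K (c.messageSpace T) + 1 := by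
  have hle := c.messageSpace_le_errorSpace hA
  obtain ⟨B, -, hBA, hB, hspan⟩ := exists_linearIndepOn_finset_extension
    (f := fun e => c.row T (Sum.inr e)) (s := ∅) (t := A) (K := K)
    (by rw [Finset.coe_empty]; exact linearIndepOn_empty K _) (Finset.empty_subset A)
  have hBcard := finrank_span_image_of_linearIndepOn hB
  have hspan' : c.errorSpace T B = c.errorSpace T A := hspan
  change Module.finrank K (c.errorSpace T B) = B.card at hBcard
  rw [hspan'] at hBcard
  have h1 := Submodule.finrank_mono hle
  have h2 := Finset.card_le_card hBA
  -- With this size, the dimensions of `Δ(T, ρ)` and `Φ(T)` add up to one more than that of `Δ(T,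
  -- A)`, which contains both.
  obtain ⟨ρ, hρB, hρ⟩ := Finset.exists_subset_card_eq
    (s := B) (n := B.card - Module.finrank K (c.messageSpace T) + 1) (by omega)
  refine ⟨ρ, fun hbot => ?_, by omega⟩
  have h3 : Module.finrank K (c.errorSpace T ρ) = ρ.card :=
    finrank_span_image_of_linearIndepOn (hB.mono (Finset.coe_subset.2 hρB))
  have h4 := Submodule.finrank_sup_add_finrank_inf_eq (c.errorSpace T ρ) (c.messageSpace T)
  rw [hbot, finrank_bot] at h4
  have h5 := Submodule.finrank_mono
    (sup_le ((c.errorSpace_mono T hρB).trans hspan'.le) hle)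
  omega

theorem linearIndepOn_range_inl_iff (c : G.Code K n) (T : Finset V) :
    LinearIndepOn K (c.row T) (Set.range Sum.inl) ↔
      n ≤ Module.finrank K (c.messageSpace T) := by
  rw [linearIndepOn_range_iff Sum.inl_injective, linearIndependent_iff_card_le_finrank_span,
    Fintype.card_fin]
  rfl

theorem linearIndepOn_image_inr_iff (c : G.Code K n) (T : Finset V) (ρ : Set E) :
    LinearIndepOn K (c.row T) (Sum.inr '' ρ) ↔
      LinearIndepOn K (fun e => c.row T (Sum.inr e)) ρ :=
  ⟨fun h => h.comp_of_image Sum.inr_injective.injOn, fun h => h.image_of_comp Sum.inr (c.row T)⟩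

/-- Independent error patterns extend to independent error patterns of prescribed size. -/
theorem exists_linearIndepOn_errors_extension {N : ℕ} (g : G.Code K N) {T : Finset V}
    (hT : G.source ∉ T) (hg : LinearIndepOn K (g.row T) (Set.range Sum.inl)) {ρ : Finset E}
    (hρ : LinearIndepOn K (fun e => g.row T (Sum.inr e)) (ρ : Set E)) {δ : ℕ} (h1 : ρ.card ≤ δ)
    (h2 : δ ≤ N) : ∃ ρ' : Finset E, ρ ⊆ ρ' ∧ ρ'.card = δ ∧
      LinearIndepOn K (fun e => g.row T (Sum.inr e)) (ρ' : Set E) := by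
  obtain ⟨b, hρb, -, hb, hspan⟩ := exists_linearIndepOn_finset_extension hρ (Finset.subset_univ ρ)
  have h3 : Module.finrank K (g.errorSpace T Finset.univ) = b.card := by
    rw [← finrank_span_image_of_linearIndepOn hb, hspan]
    rfl
  -- All channels together form a cut, so the maximal independent pattern `b` has at least `N`
  -- elements.
  have h4 := Submodule.finrank_mono (g.messageSpace_le_errorSpace (G.isCut_univ hT))
  have h5 := (g.linearIndepOn_range_inl_iff T).1 hg
  obtain ⟨ρ', h6, h7, h8⟩ := Finset.exists_subsuperset_card_eq hρb h1 (by omega)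
  exact ⟨ρ', h6, h8, hb.mono (Finset.coe_subset.2 h7)⟩

/-- Exchange between messages and errors. -/
theorem exists_linearIndepOn_messages_union {N : ℕ} (g : G.Code K N) {T : Finset V}
    (hg : LinearIndepOn K (g.row T) (Set.range Sum.inl)) {ρ : Finset E}
    (hρ : LinearIndepOn K (fun e => g.row T (Sum.inr e)) (ρ : Set E)) (hn : n + ρ.card ≤ N) :
    ∃ c : G.Code K n,
      LinearIndepOn K (c.row T) (Set.range Sum.inl ∪ Sum.inr '' (ρ : Set E)) := by
  classical
  rw [← g.linearIndepOn_image_inr_iff] at hρ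
  obtain ⟨b, hρb, hbt, hb, hspan⟩ := exists_linearIndepOn_finset_extension
    (s := ρ.map Function.Embedding.inr)
    (t := Finset.univ.map Function.Embedding.inl ∪ ρ.map Function.Embedding.inr)
    (f := g.row T) (K := K) (by simpa using hρ) Finset.subset_union_right
  have h1 := finrank_span_image_of_linearIndepOn hb
  rw [hspan] at h1
  have h2 : Module.finrank K (g.messageSpace T) ≤ b.card := by
    rw [← h1, g.messageSpace_eq_span_image]
    refine Submodule.finrank_mono (Submodule.span_mono (Set.image_mono ?_))
    rintro _ ⟨i, rfl⟩
    simp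
  have h3 := (g.linearIndepOn_range_inl_iff T).1 hg
  have h4 : b.toRight ⊆ ρ := by
    intro e he
    have := hbt (Finset.mem_toRight.1 he)
    simpa using this
  have h5 := Finset.card_le_card h4
  have h6 := Finset.card_toLeft_add_card_toRight (u := b)
  -- The basis `b` has at least `N` elements, at most `|ρ|` of them errors, so at least `n` messages
  -- survive; the others are discarded by relabelling.
  obtain ⟨S, hS, hScard⟩ := Finset.exists_subset_card_eq (s := b.toLeft) (n := n) (by omega)
  let σ : Fin n → Fin N := S.orderEmbOfFin hScard
  obtain ⟨c, hc⟩ := g.exists_row_relabel σ T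
  refine ⟨c, ?_⟩
  have hc' : c.row T = g.row T ∘ Sum.map σ id := funext hc
  rw [hc']
  refine LinearIndepOn.comp_of_image (hb.mono ?_) ?_
  · rintro _ ⟨x, ⟨i, rfl⟩ | ⟨e, he, rfl⟩, rfl⟩
    · exact Finset.mem_toLeft.1 (hS (Finset.orderEmbOfFin_mem S hScard i))
    · exact hρb (by simpa using he)
  · exact (Sum.map_injective.2 ⟨(S.orderEmbOfFin hScard).injective,
      Function.injective_id⟩).injOn

/-- A code of the dimension of the flow in general position with respect to `T`. -/
theorem exists_generic_linearIndepOn_messages (G : Network V E) (K : Type w) [Field K] [Infinite K]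
    {T : Finset V} (hT : G.source ∉ T) {N : ℕ} (hN : N ≤ G.minCut T) :
    ∃ g : G.Code K N, LinearIndepOn K (g.row T) (Set.range Sum.inl) ∧
      ∀ X : Set (Fin N ⊕ E), ∀ c : G.Code K N, LinearIndepOn K (c.row T) X →
        LinearIndepOn K (g.row T) X := by
  obtain ⟨g, hg⟩ := exists_generic G K N T
  obtain ⟨c, hc⟩ := G.exists_code_min_le_finrank_messageSpace K N hT
  refine ⟨g, hg _ c ((c.linearIndepOn_range_inl_iff T).2 ?_), hg⟩
  rwa [min_eq_left hN] at hc

/-- Fixing the index set `S` turns the rank requirement at a collection with `C_T < ω` into a single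
independence condition, which accounts for the summand `|V_3|`. -/
theorem exists_linearIndepOn_messages (G : Network V E) (K : Type w) [Field K] [Infinite K]
    {T : Finset V} (hT : G.source ∉ T) {N : ℕ} (hN : N ≤ G.minCut T) (hn : N ≤ n) :
    ∃ S : Finset (Fin n), N ≤ S.card ∧ ∃ c : G.Code K n,
      LinearIndepOn K (c.row T) (Sum.inl '' (S : Set (Fin n))) := by
  obtain ⟨c, hc⟩ := G.exists_code_min_le_finrank_messageSpace K n hT
  obtain ⟨S, -, -, hS, hspan⟩ := exists_linearIndepOn_finset_extension
    (f := fun i : Fin n => c.row T (Sum.inl i)) (s := ∅) (t := Finset.univ) (K := K)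
    (by rw [Finset.coe_empty]; exact linearIndepOn_empty K _) (Finset.empty_subset _)
  have h1 := finrank_span_image_of_linearIndepOn hS
  rw [hspan, Finset.coe_univ, Set.image_univ] at h1
  have h2 : Module.finrank K (c.messageSpace T) = S.card := h1
  exact ⟨S, by omega, c, hS.image_of_comp Sum.inl (c.row T)⟩

end Rows

section Restrict

variable {V : Type u} {E : Type v} [Fintype V] [Fintype E] [DecidableEq V] [DecidableEq E]
  {G : Network V E} {K : Type w} [Field K] {n : ℕ}

theorem linearIndepOn_row_restrict (c : G.enlarged.Code K n) (T : G.Coll) {S : Set (Fin n)}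
    (h : LinearIndepOn K (c.row {Sum.inr T}) (Sum.inl '' S)) :
    LinearIndepOn K (c.restrict.row T.1) (Sum.inl '' S) := by
  obtain ⟨L, hL⟩ := c.exists_linearMap_row_restrict T
  have h1 : LinearIndepOn K (c.row {Sum.inr T} ∘ Sum.inl) S :=
    h.comp_of_image Sum.inl_injective.injOn
  refine LinearIndepOn.image_of_comp Sum.inl _ (LinearIndepOn.of_comp L ?_)
  have h2 : L ∘ c.restrict.row T.1 ∘ Sum.inl = c.row {Sum.inr T} ∘ Sum.inl :=
    funext fun i => hL (Sum.inl i)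
  rw [h2]
  exact h1

/-- If the messages can be told apart from small errors at `t_T`, then also at `T`. -/
theorem errorSpace_inf_messageSpace_restrict (c : G.enlarged.Code K n) (T : G.Coll) {δ : ℕ}
    (hmsg : LinearIndepOn K (c.row {Sum.inr T}) (Set.range Sum.inl))
    (h : ∀ ρ : Finset (E ⊕ G.NewChannel),
      Module.finrank K (c.errorSpace {Sum.inr T} ρ) ≤ δ →
        Disjoint (c.messageSpace {Sum.inr T}) (c.errorSpace {Sum.inr T} ρ))
    {ρ : Finset E} (hρ : Module.finrank K (c.restrict.errorSpace T.1 ρ) ≤ δ) :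
    c.restrict.errorSpace T.1 ρ ⊓ c.restrict.messageSpace T.1 = ⊥ := by
  obtain ⟨L, hL⟩ := c.exists_linearMap_row_restrict T
  have hΔ : (c.restrict.errorSpace T.1 ρ).map L =
      c.errorSpace {Sum.inr T} (ρ.map Function.Embedding.inl) := by
    rw [errorSpace, errorSpace, Submodule.map_span, Set.image_image, Finset.coe_map,
      Set.image_image]
    congr 1
    exact Set.image_congr fun e _ => hL (Sum.inr e)
  have hΦ : (c.restrict.messageSpace T.1).map L = c.messageSpace {Sum.inr T} := by
    rw [messageSpace, messageSpace, Submodule.map_span, ← Set.range_comp]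
    congr 2
    funext i
    exact hL (Sum.inl i)
  have hdis := h (ρ.map Function.Embedding.inl) (by
    rw [← hΔ]
    exact (Submodule.finrank_map_le L _).trans hρ)
  -- `L` is injective on `Φ(T)`, because the images of the message rows are independent.
  have hker : Disjoint (c.restrict.messageSpace T.1) (LinearMap.ker L) := by
    refine Submodule.range_ker_disjoint ?_
    have h2 : (L ∘ fun i => c.restrict.row T.1 (Sum.inl i)) = c.row {Sum.inr T} ∘ Sum.inl :=
      funext fun i => hL (Sum.inl i)
    rw [h2]
    exact (linearIndepOn_range_iff Sum.inl_injective _).1 hmsg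
  rw [Submodule.eq_bot_iff]
  intro x hx
  obtain ⟨hxΔ, hxΦ⟩ := Submodule.mem_inf.1 hx
  refine Submodule.disjoint_def.1 hker x hxΦ (LinearMap.mem_ker.2 ?_)
  refine Submodule.disjoint_def.1 hdis (L x) ?_ ?_
  · rw [← hΦ]
    exact Submodule.mem_map_of_mem hxΦ
  · rw [← hΔ]
    exact Submodule.mem_map_of_mem hxΔ

end Restrict

end Code

end Network

end LNEC

/-! ### From conditions at the new nodes to a dispersion MDS code -/

namespace LNEC

namespace Network

namespace Code

variable {V : Type u} {E : Type v} [Fintype V] [Fintype E] [DecidableEq V] [DecidableEq E]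

/-- Conditions on a code on the enlarged network under which its restriction is a dispersion MDS
code. -/
theorem isDispersionMDS_restrict {G : Network V E} {F : Type w} [Field F] {n : ℕ} (hn : 1 ≤ n)
    (c : G.enlarged.Code F n)
    (hsmall : ∀ T : G.Coll, G.minCut T.1 < n → ∃ S : Finset (Fin n), G.minCut T.1 ≤ S.card ∧
      LinearIndepOn F (c.row {Sum.inr T}) (Sum.inl '' (S : Set (Fin n))))
    (hlarge : ∀ T : G.Coll, n ≤ G.minCut T.1 →
      LinearIndepOn F (c.row {Sum.inr T}) (Set.range Sum.inl) ∧
      ∀ ρ : Finset (E ⊕ G.NewChannel),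
        Module.finrank F (c.errorSpace {Sum.inr T} ρ) ≤ G.minCut T.1 - n →
          Disjoint (c.messageSpace {Sum.inr T}) (c.errorSpace {Sum.inr T} ρ)) :
    c.restrict.IsDispersionMDS := by
  have hsup : c.restrict.StronglySupRegular := by
    intro T
    obtain ⟨A, hA, hAcard⟩ := G.exists_isCut_card_eq_minCut T.2.2
    refine le_antisymm (le_min ?_ ?_) ?_
    · exact (finrank_range_le_card _).trans (Fintype.card_fin n).le
    · rw [← hAcard]
      exact (Submodule.finrank_mono (c.restrict.messageSpace_le_errorSpace hA)).trans
        (c.restrict.finrank_errorSpace_le_card T.1 A)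
    · rcases lt_or_ge (G.minCut T.1) n with h | h
      · obtain ⟨S, hS, hind⟩ := hsmall T h
        have h1 := (c.linearIndepOn_row_restrict T hind).comp_of_image Sum.inl_injective.injOn
        have h2 := finrank_span_image_of_linearIndepOn h1
        have h3 : Module.finrank F (Submodule.span F
            ((c.restrict.row T.1 ∘ Sum.inl) '' (S : Set (Fin n)))) ≤
            Module.finrank F (c.restrict.messageSpace T.1) :=
          Submodule.finrank_mono (Submodule.span_mono (Set.image_subset_range _ _))
        exact (min_le_right _ _).trans (hS.trans (h2.symm.le.trans h3))
      · refine (min_le_left _ _).trans ((c.restrict.linearIndepOn_range_inl_iff T.1).1 ?_)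
        rw [← Set.image_univ]
        exact c.linearIndepOn_row_restrict T (by rw [Set.image_univ]; exact (hlarge T h).1)
  refine ⟨hsup, fun T => ?_⟩
  obtain ⟨A, hA, hAcard⟩ := G.exists_isCut_card_eq_minCut T.2.2
  have hdim := hsup T
  refine ⟨fun h => hasMinDistance_of_le _ (fun ρ hρ => ?_) ?_,
    fun hpos h => hasMinDistance_of_le _ (fun ρ hρ => ?_) ?_⟩
  · by_contra! hlt
    obtain ⟨hmsg, hdis⟩ := hlarge T h
    exact hρ (c.errorSpace_inf_messageSpace_restrict T hmsg hdis (Nat.le_of_lt_succ hlt))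
  · rw [min_eq_left h] at hdim
    obtain ⟨ρ, hρ, hcard⟩ := c.restrict.exists_confusable_card_le hA (by omega)
    exact ⟨ρ, hρ, by omega⟩
  -- Distance `1` needs no condition on errors: a zero error space meets nothing.
  · by_contra! hlt
    refine hρ ?_
    rw [Submodule.finrank_eq_zero.1 (Nat.lt_one_iff.1 hlt), bot_inf_eq]
  · rw [min_eq_right h.le] at hdim
    obtain ⟨ρ, hρ, hcard⟩ := c.restrict.exists_confusable_card_le hA (by omega)
    exact ⟨ρ, hρ, by omega⟩

end Code

end Network

end LNEC

/-! ### Counting the conditions and choosing the code -/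

open LNEC LNEC.Network LNEC.Network.Code

set_option synthInstance.maxSize 1000 in
theorem mainTheorem3 {V : Type u} {E : Type v} [Fintype V] [Fintype E]
    [DecidableEq V] [DecidableEq E] (G : LNEC.Network V E)
    (ω : ℕ) (hω : 1 ≤ ω) (F : Type w) [Field F]
    (hF : (LNEC.Network.dispersionBound.{w} G ω : ℕ∞) < ENat.card F) :
    ∃ c : G.Code F ω, c.IsDispersionMDS := by
  -- Generic codes need an infinite field, and `F` may be finite. The closure stays in the universe
  -- over which `errorRank` quantifies.
  let K := AlgebraicClosure F
  have hsrc : ∀ T : G.Coll,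
      G.enlarged.source ∉ ({Sum.inr T} : Finset (V ⊕ G.Coll)) := by
    intro T
    simp [enlarged]
  choose g hgmsg hg using fun T : G.Coll =>
    exists_generic_linearIndepOn_messages G.enlarged K (hsrc T) (G.minCut_le_minCut_enlarged T)
  let R : G.Coll → Finset (Finset (E ⊕ G.NewChannel)) := fun T =>
    (Set.toFinite {ρ : Finset (E ⊕ G.NewChannel) | ρ.card = G.minCut T.1 - ω ∧
      LinearIndepOn K (fun e => (g T).row {Sum.inr T} (Sum.inr e))
        (ρ : Set (E ⊕ G.NewChannel))}).toFinset
  have hR : ∀ T, (R T).card ≤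
      (fullRankPatterns.{w} G.enlarged {Sum.inr T} (G.minCut T.1 - ω)).ncard := by
    intro T
    rw [← Set.ncard_coe_finset]
    refine Set.ncard_le_ncard (fun ρ hρ => ?_) (Set.toFinite _)
    obtain ⟨h1, h2⟩ := (Set.Finite.mem_toFinset _).1 hρ
    rw [← h1]
    exact (g T).mem_fullRankPatterns h2
  have hsmall : ∀ T : {T : G.Coll // G.minCut T.1 < ω}, ∃ S : Finset (Fin ω),
      G.minCut T.1.1 ≤ S.card ∧ ∃ c : G.enlarged.Code K ω,
        LinearIndepOn K (c.row {Sum.inr T.1}) (Sum.inl '' (S : Set (Fin ω))) := fun T =>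
    exists_linearIndepOn_messages G.enlarged K (hsrc T.1) (G.minCut_le_minCut_enlarged T.1) T.2.le
  choose S hScard hS using hsmall
  let J := (Σ T : {T : G.Coll // ω ≤ G.minCut T.1}, {ρ // ρ ∈ R T.1}) ⊕
    {T : G.Coll // G.minCut T.1 < ω}
  let node : J → G.Coll := Sum.elim (fun x => x.1.1) (fun T => T.1)
  let rows : J → Set (Fin ω ⊕ (E ⊕ G.NewChannel)) := Sum.elim
    (fun x => Set.range Sum.inl ∪ Sum.inr '' (x.2.1 : Set (E ⊕ G.NewChannel)))
    (fun T => Sum.inl '' (S T : Set (Fin ω)))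
  have hJ : Fintype.card J ≤ dispersionBound.{w} G ω := by
    rw [Fintype.card_sum, Fintype.card_sigma, dispersionBound]
    refine Nat.add_le_add ?_ (Fintype.card_subtype _).le
    rw [Finset.sum_subtype (p := fun T : G.Coll => ω ≤ G.minCut T.1) _ (by simp)]
    refine Finset.sum_le_sum fun T _ => ?_
    rw [Fintype.card_coe]
    exact hR T.1
  obtain ⟨b, hb⟩ := exists_common_point (F := F) (K := K) (J := J)
    (lt_of_le_of_lt (by exact_mod_cast hJ) hF)
    (fun j a => LinearIndepOn K ((ofPoint G.enlarged a).row {Sum.inr (node j)}) (rows j))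
    (fun j a ha i x y hx hy => eq_of_not_linearIndepOn_row_update G.enlarged ha i hx hy)
    (by
      rintro (⟨⟨T, hT⟩, ρ, hρ⟩ | T)
      · obtain ⟨h1, h2⟩ := (Set.Finite.mem_toFinset _).1 hρ
        change ρ.card = G.minCut T.1 - ω at h1
        obtain ⟨c, hc⟩ := (g T).exists_linearIndepOn_messages_union (n := ω) (hgmsg T) h2 (by omega)
        obtain ⟨a, ha⟩ := c.exists_row_ofPoint
        exact ⟨a, by rw [ha]; exact hc⟩
      · obtain ⟨c, hc⟩ := hS T
        obtain ⟨a, ha⟩ := c.exists_row_ofPoint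
        exact ⟨a, by rw [ha]; exact hc⟩)
  replace hb := fun j => (linearIndepOn_row_ofPoint_algebraMap b _ _).1 (hb j)
  let c : G.enlarged.Code F ω := ofPoint G.enlarged b
  refine ⟨c.restrict, isDispersionMDS_restrict hω c
    (fun T hT => ⟨S ⟨T, hT⟩, hScard ⟨T, hT⟩, hb (Sum.inr ⟨T, hT⟩)⟩) fun T hT => ?_⟩
  -- A small pattern independent in `c` is independent in the generic code too, and there it extends
  -- to a tested pattern.
  have hunion : ∀ ρ₀ : Finset (E ⊕ G.NewChannel), ρ₀.card ≤ G.minCut T.1 - ω →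
      LinearIndepOn F (fun e => c.row {Sum.inr T} (Sum.inr e)) (ρ₀ : Set (E ⊕ G.NewChannel)) →
      ∃ ρ : Finset (E ⊕ G.NewChannel), ρ₀ ⊆ ρ ∧ LinearIndepOn F (c.row {Sum.inr T})
        (Set.range Sum.inl ∪ Sum.inr '' (ρ : Set (E ⊕ G.NewChannel))) := by
    intro ρ₀ hcard hind
    rw [← c.linearIndepOn_image_inr_iff, ← linearIndepOn_row_ofPoint_algebraMap (K := K)] at hind
    -- `g T` has `C_T` messages rather than `ω`. Only error rows are compared, so any relabelling
    -- will do, such as a constant one.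
    obtain ⟨c', hc'⟩ := (ofPoint G.enlarged fun i => algebraMap F K (b i)).exists_row_relabel
      (fun _ : Fin (G.minCut T.1) => (⟨0, hω⟩ : Fin ω)) {Sum.inr T}
    have h1 : LinearIndepOn K (fun e => c'.row {Sum.inr T} (Sum.inr e))
        (ρ₀ : Set (E ⊕ G.NewChannel)) := by
      rw [linearIndepOn_image_inr_iff] at hind
      have h2 : (fun e => c'.row {Sum.inr T} (Sum.inr e)) = fun e =>
          (ofPoint G.enlarged fun i => algebraMap F K (b i)).row {Sum.inr T} (Sum.inr e) :=
        funext fun e => hc' (Sum.inr e)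
      rw [h2]
      exact hind
    rw [← c'.linearIndepOn_image_inr_iff] at h1
    have h3 := ((g T).linearIndepOn_image_inr_iff _ _).1 (hg T _ c' h1)
    obtain ⟨ρ, hsub, hρcard, hρ⟩ := (g T).exists_linearIndepOn_errors_extension (hsrc T) (hgmsg T)
      h3 hcard (Nat.sub_le _ _)
    exact ⟨ρ, hsub, hb (Sum.inl ⟨⟨T, hT⟩, ρ,
      (Set.Finite.mem_toFinset _).2 ⟨hρcard, hρ⟩⟩)⟩
  constructor
  · obtain ⟨ρ, -, hρ⟩ := hunion ∅ (Nat.zero_le _)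
      (by rw [Finset.coe_empty]; exact linearIndepOn_empty F _)
    exact hρ.mono Set.subset_union_left
  · intro ρ hρ
    -- The hypothesis bounds the dimension and not the size of `ρ`, so `ρ` is first thinned to a
    -- basis of its error space.
    obtain ⟨ρ₀, -, -, hind, hspan⟩ := exists_linearIndepOn_finset_extension
      (f := fun e => c.row {Sum.inr T} (Sum.inr e)) (s := ∅) (t := ρ) (K := F)
      (by rw [Finset.coe_empty]; exact linearIndepOn_empty F _) (Finset.empty_subset _)
    have hspan' : c.errorSpace {Sum.inr T} ρ₀ = c.errorSpace {Sum.inr T} ρ := hspan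
    have hcard : Module.finrank F (c.errorSpace {Sum.inr T} ρ₀) = ρ₀.card :=
      finrank_span_image_of_linearIndepOn hind
    obtain ⟨ρ₁, hsub, hρ₁⟩ := hunion ρ₀ (by rw [← hcard, hspan']; exact hρ) hind
    have hdis := ((linearIndepOn_union_iff (by
      rw [Set.disjoint_left]
      rintro _ ⟨i, rfl⟩ ⟨e, -, h⟩
      cases h)).1 hρ₁).2.2
    rw [← c.messageSpace_eq_span_image, ← c.errorSpace_eq_span_image] at hdis
    exact hdis.mono_right (hspan'.symm.le.trans (c.errorSpace_mono _ hsub))
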